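/- **Uniform ergodicity of the conjugate Gibbs sampler for regularized Bayesian bridge probit regression.** Let $n,p\ge 0$ be integers, $X\in\mathbb R^{n\times p}$ with rows $x_i^\top$, $y\in\{0,1\}^n$, $\zeta>0$, $0<\alpha<1$. Let $\mathcal N(\cdot\,;m,v)$ be the Gaussian density with mean $m$ and variance $v$, and $\Phi$ the standard normal distribution function. Put $$L(\beta)=\prod_{i=1}^n\Phi(x_i^\top\beta)^{y_i}\bigl(1-\Phi(x_i^\top\beta)\bigr)^{1-y_i},\qquad \beta\in\mathbb R^p .$$ The Bayesian bridge local scale prior is $\pi_{\rm loc}(\lambda)\propto\lambda^{-2}\,\pi_{\rm st}(\lambda^{-2}/2)$ on $(0,\infty)$, where $\pi_{\rm st}$ is the density of the one-sided stable distribution with location $0$, skewness $1$, characteristic exponent $a=\alpha/2$ and scale $c=\cos(\alpha\pi/4)^{2/\alpha}$, i.e. with characteristic function $\exp\{-|ct|^{a}(1-i\,\mathrm{sgn}(t)\tan(\pi a/2))\}$; equivalently $\int_0^\infty\mathcal N(b;0,\tau^2\lambda^2)\,\pi_{\rm loc}(\lambda)\,d\lambda\propto\tau^{-1}e^{-|b/\tau|^\alpha}$.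 Let the global scale prior $\pi_{\rm glo}$ be supported on $[\tau_{\min},\infty)$ with $\tau_{\min}>0$; it is a probability measure or, more generally, a nonzero (possibly improper) s-finite Borel measure with $\int\tau^{-p}\,\pi_{\rm glo}(d\tau)<\infty$ (which is automatic for a probability measure on $[\tau_{\min},\infty)$). The model is $\tau\sim\pi_{\rm glo}$, $\lambda_j\sim\pi_{\rm loc}$, $\beta_j\mid\tau,\lambda_j\sim\mathcal N(0,\tau^2\lambda_j^2)$, $y_i\mid\beta\sim\mathrm{Bernoulli}(\Phi(x_i^\top\beta))$, regularized by fictitious data $z_j=0$ with $z_j\mid\beta_j\sim\mathcal N(\beta_j,\zeta^2)$. One cycle of the conjugate Gibbs sampler moves $(\beta^*,\lambda^*,\tau^*)$ to $(\beta,\lambda,\tau)$ by drawing successively 1. $\tau\mid\beta^*$ from its conditional with the local scales integrated out, proportional to $\Bigl(\prod_{j}\int_0^\infty\mathcal N(\beta_j^*;0,\tau^2l^2)\,\pi_{\rm loc}(l)\,dl\Bigr)\pi_{\rm glo}(d\tau)$, that is, to $\tau^{-p}\prod_j e^{-|\beta_j^*/\tau|^\alpha}\,\pi_{\rm glo}(d\tau)$;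 2. $\lambda\mid\beta^*,\tau$ from the density proportional to $\prod_j\frac1{\tau\lambda_j}\exp\bigl(-\frac{(\beta_j^*)^2}{2\tau^2\lambda_j^2}\bigr)\pi_{\rm loc}(\lambda_j)$ on $(0,\infty)^p$; 3. $\beta\mid\tau,\lambda,y,X,z=0$ from the density proportional to $L(\beta)\prod_j\mathcal N(0;\beta_j,\zeta^2)\,\mathcal N(\beta_j;0,\tau^2\lambda_j^2)$ on $\mathbb R^p$. Then this sampler is uniformly ergodic. Namely, with $P$ its Markov transition kernel on states $(\beta,\lambda,\tau)$ and $\Pi$ the posterior distribution of $(\beta,\lambda,\tau)$ given $y,X,z=0$ (a probability measure), $\Pi$ is invariant for $P$ and there are constants $C<\infty$ and $\rho\in[0,1)$ such that $$\sup_{A}\bigl|P^m(s,A)-\Pi(A)\bigr|\le C\rho^m\qquad\text{for every } m\ge 0\text{ and every initial state } s .$$ Moreover the marginal chain $\beta^*\to\beta$ satisfies a minorization condition on the whole space: its transition density $P(\beta\mid\beta^*)$ with respect to Lebesgue measure satisfies $P(\beta\mid\beta^*)\ge\delta\,\varphi(\beta)$ for all $\beta^*,\beta\in\mathbb R^p$,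 for some constant $\delta>0$ and some probability density $\varphi$. -/

import Mathlib

open MeasureTheory ProbabilityTheory
open scoped ENNReal NNReal

/-! ### Uniform ergodicity of Markov chains -/

/-- A Markov transition kernel `P` on `S` is uniformly ergodic with limit `π`: `P` is Markov,
`π` is an invariant probability measure of `P`, and the `n`-step law converges to `π` in total
variation, geometrically fast and uniformly in the starting state. (The bound over all measurable
sets `A` is a bound on the total variation distance `sup_A |Pⁿ(x, A) - π(A)|`.) -/
def UniformlyErgodic {S : Type*} [MeasurableSpace S] (P : Kernel S S) (π : Measure S) : Prop :=
  IsMarkovKernel P ∧ IsProbabilityMeasure π ∧ P.Invariant π ∧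
    ∃ C ρ : ℝ, 0 ≤ ρ ∧ ρ < 1 ∧ ∀ (n : ℕ) (x : S) (A : Set S), MeasurableSet A →
      |((P ^ n) x).real A - π.real A| ≤ C * ρ ^ n

/-- The transition density `f x y` of a chain, with respect to the measure `μ`, satisfies a
minorization condition `f x y ≥ δ φ(y)` on the whole state space, for a constant `δ > 0` and a
probability density `φ`. -/
def UniformMinorization {S : Type*} [MeasurableSpace S] (μ : Measure S)
    (f : S → S → ℝ≥0∞) : Prop :=
  ∃ (δ : ℝ) (φ : S → ℝ≥0∞), 0 < δ ∧ Measurable φ ∧ ∫⁻ y, φ y ∂μ = 1 ∧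
    ∀ x y, ENNReal.ofReal δ * φ y ≤ f x y

/-! ### The stable distribution and the bridge prior -/

/-- Characteristic function of the stable distribution with characteristic exponent `a ≠ 1`,
skewness `b`, scale `c` and location `m`:
`t ↦ exp (i m t - |c t| ^ a (1 - i b sgn(t) tan(π a / 2)))`. -/
noncomputable def stableCharFun (a b c m t : ℝ) : ℂ :=
  Complex.exp (Complex.I * (m * t : ℝ) -
    ((|c * t| ^ a : ℝ) : ℂ) *
      (1 - Complex.I * ((b * SignType.sign t * Real.tan (Real.pi * a / 2) : ℝ) : ℂ)))

/-- Density of the stable distribution, by Fourier inversion of its (integrable) characteristic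
function: `(2π)⁻¹ ∫ exp(-i t x) φ(t) dt`. -/
noncomputable def stableDensity (a b c m x : ℝ) : ℝ :=
  (2 * Real.pi)⁻¹ *
    (∫ t : ℝ, Complex.exp (-(Complex.I * (t * x : ℝ))) * stableCharFun a b c m t).re

/-- Density of the one-sided stable distribution used by the Bayesian bridge with exponent `α`:
location `0`, skewness `1`, characteristic exponent `α / 2`, scale `cos(α π / 4) ^ (2 / α)`. Its
Laplace transform is `s ↦ exp(-s ^ (α / 2))`. -/
noncomputable def oneSidedStableDensity (α x : ℝ) : ℝ :=
  stableDensity (α / 2) 1 (Real.cos (α * Real.pi / 4) ^ (2 / α)) 0 x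

/-- Local scale prior density of the Bayesian bridge on `(0, ∞)`, up to its normalizing constant
(which cancels in every normalized density below): `π_loc(l) ∝ l⁻² π_st(l⁻² / 2)`. The
corresponding Gaussian scale mixture is `π(b | τ) ∝ τ⁻¹ exp(-|b / τ| ^ α)`. -/
noncomputable def bridgeLocalDensity (α l : ℝ) : ℝ≥0∞ :=
  ENNReal.ofReal (l ^ (-2 : ℤ) * oneSidedStableDensity α (l ^ (-2 : ℤ) / 2))

/-- `π` is a (possibly improper) prior for the global scale, supported on `[τmin, ∞)`, in the model
with `p` coefficients. The condition `integrable` makes the posterior proper. It holds for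
every finite measure on `[τmin, ∞)`, `τmin > 0`: see `IsGlobalScalePrior.of_isFiniteMeasure`. -/
structure IsGlobalScalePrior (p : ℕ) (τmin : ℝ) (π : Measure ℝ) : Prop where
  ne_zero : π ≠ 0
  support : π (Set.Iio τmin) = 0
  integrable : ∫⁻ τ, ENNReal.ofReal ((τ ^ p)⁻¹) ∂π < ∞

/-- Every proper prior supported on `[τmin, ∞)`, `τmin > 0`, is covered. -/
theorem IsGlobalScalePrior.of_isFiniteMeasure (p : ℕ) {τmin : ℝ} (hτ : 0 < τmin)
    (π : Measure ℝ) [IsFiniteMeasure π] (h0 : π ≠ 0) (hs : π (Set.Iio τmin) = 0) :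
    IsGlobalScalePrior p τmin π := by
  refine ⟨h0, hs, ?_⟩
  have hae : ∀ᵐ τ ∂π, τmin ≤ τ := by
    rw [ae_iff]
    simpa [Set.Iio] using hs
  calc ∫⁻ τ, ENNReal.ofReal ((τ ^ p)⁻¹) ∂π
      ≤ ∫⁻ _, ENNReal.ofReal ((τmin ^ p)⁻¹) ∂π := by
        refine lintegral_mono_ae ?_
        filter_upwards [hae] with τ h
        gcongr
    _ < ∞ := by
        rw [lintegral_const]
        exact ENNReal.mul_lt_top ENNReal.ofReal_lt_top (measure_lt_top π _)

/-! ### The regularized bridge probit model -/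

/-- The standard normal distribution function `Φ`. -/
noncomputable def stdNormalCDF (t : ℝ) : ℝ := cdf (gaussianReal 0 1) t

/-- Probit likelihood `∏ᵢ Φ(xᵢᵀ β) ^ yᵢ (1 - Φ(xᵢᵀ β)) ^ (1 - yᵢ)`; `xᵢ` is the `i`-th row of `X`
and `y i = true` encodes `yᵢ = 1`. -/
noncomputable def probitLikelihood {n p : ℕ} (X : Matrix (Fin n) (Fin p) ℝ) (y : Fin n → Bool)
    (β : Fin p → ℝ) : ℝ≥0∞ :=
  ∏ i, ENNReal.ofReal
    (if y i then stdNormalCDF (X.mulVec β i) else 1 - stdNormalCDF (X.mulVec β i))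

/-- Likelihood of the fictitious data `z = 0`, where `z_j | β_j ∼ N(β_j, ζ²)`. -/
noncomputable def fictitiousLikelihood {p : ℕ} (ζ : ℝ) (β : Fin p → ℝ) : ℝ≥0∞ :=
  ∏ j, gaussianPDF (β j) (Real.toNNReal (ζ ^ 2)) 0

/-- Prior density of `β` given the scales: `β_j | τ, l_j ∼ N(0, τ² l_j²)`, independent. -/
noncomputable def coefPrior {p : ℕ} (τ : ℝ) (l β : Fin p → ℝ) : ℝ≥0∞ :=
  ∏ j, gaussianPDF 0 (Real.toNNReal (τ ^ 2 * l j ^ 2)) (β j)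

/-- Prior density of the local scales (unnormalized), independent over coordinates. -/
noncomputable def localPrior {p : ℕ} (α : ℝ) (l : Fin p → ℝ) : ℝ≥0∞ :=
  ∏ j, bridgeLocalDensity α (l j)

/-- Lebesgue measure on `(0, ∞)ᵖ`, the reference measure for the local scales. -/
noncomputable def localRef (p : ℕ) : Measure (Fin p → ℝ) :=
  Measure.pi fun _ => volume.restrict (Set.Ioi 0)

/-- The state `(β, l, τ)` of the sampler: coefficients, local scales, global scale. -/
abbrev GibbsState (p : ℕ) : Type := (Fin p → ℝ) × (Fin p → ℝ) × ℝ

/-- Reference measure on states `(β, l, τ)`: Lebesgue in `β`, Lebesgue on `(0, ∞)ᵖ` in `l`, and the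
prior `πglo` in `τ`. -/
noncomputable def stateRef (p : ℕ) (πglo : Measure ℝ) : Measure (GibbsState p) :=
  (volume : Measure (Fin p → ℝ)).prod ((localRef p).prod πglo)

/-- Unnormalized posterior density of `(β, l, τ)` given `y, X, z = 0`, with respect to `stateRef`
(so the factor `πglo` is in the reference measure). -/
noncomputable def jointDensity {n p : ℕ} (α ζ : ℝ) (X : Matrix (Fin n) (Fin p) ℝ)
    (y : Fin n → Bool) (s : GibbsState p) : ℝ≥0∞ :=
  probitLikelihood X y s.1 * fictitiousLikelihood ζ s.1 * coefPrior s.2.2 s.2.1 s.1 *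
    localPrior α s.2.1

/-- The posterior distribution of `(β, l, τ)` given `y, X, z = 0`. -/
noncomputable def bridgePosterior {n p : ℕ} (α ζ : ℝ) (X : Matrix (Fin n) (Fin p) ℝ)
    (y : Fin n → Bool) (πglo : Measure ℝ) : Measure (GibbsState p) :=
  (∫⁻ s, jointDensity α ζ X y s ∂(stateRef p πglo))⁻¹ •
    (stateRef p πglo).withDensity (jointDensity α ζ X y)

/-! ### The conjugate Gibbs sampler -/

/-- Marginal density of `β` given `τ` (unnormalized), with the local scales integrated out. -/
noncomputable def coefMarginalPrior {p : ℕ} (α τ : ℝ) (β : Fin p → ℝ) : ℝ≥0∞ :=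
  ∫⁻ l, coefPrior τ l β * localPrior α l ∂(localRef p)

/-- Step 1, the collapsed update: the conditional density (with respect to `πglo`) of `τ | β`, with
the local scales integrated out. Since the Gaussian scale mixture is the bridge density, it is
proportional to `τ ^ (-p) ∏_j exp(-|β_j / τ| ^ α)`. -/
noncomputable def globalScaleCond {p : ℕ} (α : ℝ) (πglo : Measure ℝ) (β : Fin p → ℝ)
    (τ : ℝ) : ℝ≥0∞ :=
  coefMarginalPrior α τ β / ∫⁻ τ', coefMarginalPrior α τ' β ∂πglo

/-- Step 2: the conditional density of `l | β, τ`. -/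
noncomputable def localScaleCond {p : ℕ} (α : ℝ) (β : Fin p → ℝ) (τ : ℝ)
    (l : Fin p → ℝ) : ℝ≥0∞ :=
  coefPrior τ l β * localPrior α l / ∫⁻ l', coefPrior τ l' β * localPrior α l' ∂(localRef p)

/-- Step 3: the conditional density of `β | τ, l, y, X, z = 0`. -/
noncomputable def coefCond {n p : ℕ} (ζ : ℝ) (X : Matrix (Fin n) (Fin p) ℝ) (y : Fin n → Bool)
    (τ : ℝ) (l β : Fin p → ℝ) : ℝ≥0∞ :=
  probitLikelihood X y β * fictitiousLikelihood ζ β * coefPrior τ l β /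
    ∫⁻ β', probitLikelihood X y β' * fictitiousLikelihood ζ β' * coefPrior τ l β'

/-- Transition density of one cycle `s = (β*, l*, τ*) ↦ s' = (β, l, τ)` with respect to `stateRef`:
draw `τ | β*`, then `l | β*, τ`, then `β | τ, l, y, X, z = 0`. -/
noncomputable def gibbsDensity {n p : ℕ} (α ζ : ℝ) (X : Matrix (Fin n) (Fin p) ℝ)
    (y : Fin n → Bool) (πglo : Measure ℝ) (s s' : GibbsState p) : ℝ≥0∞ :=
  globalScaleCond α πglo s.1 s'.2.2 * localScaleCond α s.1 s'.2.2 s'.2.1 *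
    coefCond ζ X y s'.2.2 s'.2.1 s'.1

/-- The transition kernel of the conjugate Gibbs sampler on the full state space. -/
noncomputable def gibbsKernel {n p : ℕ} (α ζ : ℝ) (X : Matrix (Fin n) (Fin p) ℝ)
    (y : Fin n → Bool) (πglo : Measure ℝ) [SFinite πglo] : Kernel (GibbsState p) (GibbsState p) :=
  haveI : SFinite (stateRef p πglo) := by unfold stateRef localRef; infer_instance
  (Kernel.const (GibbsState p) (stateRef p πglo)).withDensity (gibbsDensity α ζ X y πglo)

/-- Transition density (with respect to Lebesgue measure) of the marginal chain `β* ↦ β`. -/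
noncomputable def coefTransitionDensity {n p : ℕ} (α ζ : ℝ) (X : Matrix (Fin n) (Fin p) ℝ)
    (y : Fin n → Bool) (πglo : Measure ℝ) (βs β : Fin p → ℝ) : ℝ≥0∞ :=
  ∫⁻ τ, ∫⁻ l, globalScaleCond α πglo βs τ * localScaleCond α βs τ l * coefCond ζ X y τ l β
    ∂(localRef p) ∂πglo

/-! ### Asymptotics of the one-sided stable density -/

/-! A cycle forgets the current `l` and `τ`, so a minorization of the marginal chain `β* ↦ β` is
enough for Doeblin's theorem (`uniformlyErgodic_of_minorization`).

Given `τ` and `l`, the new `β` has density `W(β) K(β) / ∫ W K`, where `W` is the likelihood times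
the fictitious Gaussian and `K(β) = ∏ exp(-β_j² / (2 τ² l_j²))`. Since `K ≤ 1` and `∫ W ≤ 1` (here
the regularization enters), this is at least `W(β) K(β)` (`weight_mul_coefKernel_le`). Averaging
`K(β)` over `l | β*, τ` gives in each coordinate `M((β*² + β²) / τ²) / M(β*² / τ²)`, with `M =
bridgeMix` the Laplace transform of `l⁻¹ π_loc(l) dl` in the precision. A large `β*` only favours
large `l`, hence a large `K(β)`; in precise form, Chebyshev's inequality gives `M(s) M(t) ≤ M(s + t)
M(0)` (`bridgeMix_mul_le`). The ratio is thus at least `M(β² / τ²) / M(0) ≥ M(β² / τmin²) / M(0)`,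
free of both `β*` and `τ` (`bridgeMinorant_mul_le`), so the law of `τ | β*` plays no role.

This requires `M(0) < ∞`, that is, `∫ l⁻³ π_st(l⁻² / 2) dl < ∞`. For large `l` boundedness of `π_st`
suffices. For small `l` the tail `π_st(u) ~ A u^(-1 - α/2)` turns the integrand into `l^(α - 1)`.
The tail is extracted from the Fourier inversion formula by rotating the contour onto the negative
imaginary axis (`exists_oneSidedStableDensity_asymptotics`); as `A > 0`, it also gives `M > 0`.
Neither the closed form of the scale mixture nor nonnegativity of `π_st` everywhere is used.

Properness and invariance are the usual Gibbs cancellations, carried out for an abstract three-block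
sampler (`IsProperCollapsed`). -/

theorem integrableOn_rpow_mul_exp_neg_mul_rpow_of_pos {q b a : ℝ} (hq : -1 < q) (hb : 0 < b)
    (ha : 0 < a) :
    IntegrableOn (fun r : ℝ => r ^ q * Real.exp (-b * r ^ a)) (Set.Ioi 0) := by
  -- The Bochner integral of a non-integrable function is zero, while the Gamma formula gives a
  -- positive value.
  by_contra h
  have h1 := integral_undef h
  rw [integral_rpow_mul_exp_neg_mul_rpow ha hq hb] at h1
  have : 0 < Real.Gamma ((q + 1) / a) := Real.Gamma_pos_of_pos (div_pos (by linarith) ha)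
  have : 0 < b ^ (-(q + 1) / a) := by positivity
  have : b ^ (-(q + 1) / a) * (1 / a) * Real.Gamma ((q + 1) / a) ≠ 0 := by positivity
  contradiction

theorem tendsto_mul_exp_neg_mul_rpow {b a : ℝ} (hb : 0 < b) (ha : 0 < a) :
    Filter.Tendsto (fun r : ℝ => r * Real.exp (-b * r ^ a)) Filter.atTop (nhds 0) := by
  have h := (tendsto_rpow_mul_exp_neg_mul_atTop_nhds_zero (1 / a) b hb).comp (tendsto_rpow_atTop ha)
  refine h.congr' ?_
  filter_upwards [Filter.eventually_gt_atTop 0] with r hr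
  simp only [Function.comp]
  rw [← Real.rpow_mul hr.le, mul_one_div_cancel ha.ne', Real.rpow_one]

/-- Taylor's bound handles `‖z‖ ≤ 1`. Beyond that, `Re z ≤ 0` keeps `‖exp z‖ ≤ 1`, and `2 + ‖z‖ ≤ 3
‖z‖²`. -/
theorem Complex.norm_exp_sub_one_sub_id_le_of_re_nonpos {z : ℂ} (hz : z.re ≤ 0) :
    ‖Complex.exp z - 1 - z‖ ≤ 3 * ‖z‖ ^ 2 := by
  rcases le_total ‖z‖ 1 with h | h
  · have := Complex.norm_exp_sub_one_sub_id_le h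
    nlinarith [sq_nonneg ‖z‖]
  · have h1 : ‖Complex.exp z‖ ≤ 1 := by
      rw [Complex.norm_exp]; exact Real.exp_le_one_iff.2 hz
    have h2 := norm_sub_le (Complex.exp z - 1) z
    have h3 := norm_sub_le (Complex.exp z) 1
    rw [norm_one] at h3
    nlinarith

/-! ### Rotation of the inversion contour -/

/-- The integrand `exp (-i t u - (-i t) ^ a)` on the ray `t = r exp (-i θ)`. -/
noncomputable def stableRay (a u θ r : ℝ) : ℂ :=
  Complex.exp (-(Complex.I * (r * u : ℝ)) * Complex.exp (-(θ * Complex.I)) -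
    ((r ^ a : ℝ) : ℂ) * Complex.exp (-((Real.pi * a / 2 + a * θ : ℝ) * Complex.I)))

theorem norm_stableRay (a u θ r : ℝ) :
    ‖stableRay a u θ r‖ =
      Real.exp (-(r * u * Real.sin θ) - r ^ a * Real.cos (Real.pi * a / 2 + a * θ)) := by
  have he : ∀ x : ℝ, Complex.exp (-(x * Complex.I)) = Complex.exp ((-x : ℝ) * Complex.I) := by
    intro x; rw [Complex.ofReal_neg, neg_mul]
  rw [stableRay, Complex.norm_exp, he, he]
  congr 1
  simp only [Complex.sub_re, Complex.mul_re, Complex.exp_ofReal_mul_I_re,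
    Complex.exp_ofReal_mul_I_im, Complex.neg_re, Complex.neg_im, Complex.mul_im, Complex.I_re,
    Complex.I_im, Complex.ofReal_re, Complex.ofReal_im, Real.cos_neg, Real.sin_neg]
  ring

/-- The phase `π a / 2 + a θ` never exceeds `π a < π / 2`, and the term with `sin θ` only helps.
This single bound dominates every ray of the quarter turn. -/
theorem norm_stableRay_le {a u θ r : ℝ} (ha0 : 0 < a) (ha : a < 1 / 2) (hu : 0 < u)
    (h0 : 0 ≤ θ) (h1 : θ ≤ Real.pi / 2) (hr : 0 ≤ r) :
    ‖stableRay a u θ r‖ ≤ Real.exp (-Real.cos (Real.pi * a) * r ^ a) := by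
  rw [norm_stableRay]
  apply Real.exp_le_exp.2
  have hπ := Real.pi_pos
  have hs : 0 ≤ Real.sin θ := Real.sin_nonneg_of_nonneg_of_le_pi h0 (by linarith)
  have hc : Real.cos (Real.pi * a) ≤ Real.cos (Real.pi * a / 2 + a * θ) := by
    apply Real.cos_le_cos_of_nonneg_of_le_pi
    · positivity
    · nlinarith
    · nlinarith
  have : 0 ≤ r ^ a := Real.rpow_nonneg hr a
  have : 0 ≤ r * u * Real.sin θ := by positivity
  nlinarith

theorem measurable_stableRay (a u θ : ℝ) : Measurable (stableRay a u θ) := by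
  unfold stableRay; fun_prop

theorem hasDerivAt_stableRay_angle (a u θ r : ℝ) :
    HasDerivAt (fun θ => stableRay a u θ r)
      (stableRay a u θ r * (-(r * u : ℝ) * Complex.exp (-(θ * Complex.I)) +
        Complex.I * a * (r ^ a : ℝ) *
          Complex.exp (-((Real.pi * a / 2 + a * θ : ℝ) * Complex.I)))) θ := by
  have h1 : HasDerivAt (fun θ : ℝ => Complex.exp (-(θ * Complex.I)))
      (Complex.exp (-(θ * Complex.I)) * (-(1 * Complex.I))) θ :=
    ((((hasDerivAt_id θ).ofReal_comp).mul_const Complex.I).neg).cexp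
  have h2 : HasDerivAt
      (fun θ : ℝ => Complex.exp (-((Real.pi * a / 2 + a * θ : ℝ) * Complex.I)))
      (Complex.exp (-((Real.pi * a / 2 + a * θ : ℝ) * Complex.I)) *
        (-((a * 1 : ℝ) * Complex.I))) θ :=
    (((((hasDerivAt_id θ).const_mul a).const_add (Real.pi * a / 2)).ofReal_comp).mul_const
      Complex.I).neg.cexp
  have h3 := ((h1.const_mul (-(Complex.I * (r * u : ℝ)))).sub
    (h2.const_mul ((r ^ a : ℝ) : ℂ))).cexp
  refine h3.congr_deriv ?_
  simp only [stableRay]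
  congr 1
  push_cast
  linear_combination (r * u * Complex.exp (-(θ * Complex.I))) * Complex.I_sq

theorem hasDerivAt_stableRay_radius (a u θ : ℝ) {r : ℝ} (hr : 0 < r) :
    HasDerivAt (fun r => stableRay a u θ r)
      (stableRay a u θ r * (-(Complex.I * u) * Complex.exp (-(θ * Complex.I)) -
        (a * r ^ (a - 1) : ℝ) *
          Complex.exp (-((Real.pi * a / 2 + a * θ : ℝ) * Complex.I)))) r := by
  have h1 : HasDerivAt (fun r : ℝ => ((r * u : ℝ) : ℂ)) ((1 * u : ℝ) : ℂ) r :=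
    ((hasDerivAt_id r).mul_const u).ofReal_comp
  have h2 : HasDerivAt (fun r : ℝ => ((r ^ a : ℝ) : ℂ)) ((a * r ^ (a - 1) : ℝ) : ℂ) r :=
    (Real.hasDerivAt_rpow_const (Or.inl hr.ne')).ofReal_comp
  have h3 := ((((h1.const_mul Complex.I).neg).mul_const (Complex.exp (-(θ * Complex.I)))).sub
    (h2.mul_const (Complex.exp (-((Real.pi * a / 2 + a * θ : ℝ) * Complex.I))))).cexp
  refine h3.congr_deriv ?_
  simp only [stableRay]
  congr 1
  push_cast
  ring

/-- The derivative in `θ` of the integrand along a rotated ray. -/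
noncomputable def stableRayDeriv (a u θ r : ℝ) : ℂ :=
  Complex.exp (-(θ * Complex.I)) * stableRay a u θ r *
    (-Complex.I + (-(r * u : ℝ) * Complex.exp (-(θ * Complex.I)) +
        Complex.I * a * (r ^ a : ℝ) *
          Complex.exp (-((Real.pi * a / 2 + a * θ : ℝ) * Complex.I))))

theorem norm_stableRayDeriv_le {a u θ r : ℝ} (ha0 : 0 < a) (ha : a < 1 / 2) (hu : 0 < u)
    (h0 : 0 ≤ θ) (h1 : θ ≤ Real.pi / 2) (hr : 0 ≤ r) :
    ‖stableRayDeriv a u θ r‖ ≤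
      (1 + r * u + r ^ a) * Real.exp (-Real.cos (Real.pi * a) * r ^ a) := by
  have hn : ∀ x : ℝ, ‖Complex.exp (-(x * Complex.I))‖ = 1 := by
    intro x
    rw [← neg_mul, ← Complex.ofReal_neg, Complex.norm_exp_ofReal_mul_I]
  have hra : 0 ≤ r ^ a := Real.rpow_nonneg hr a
  rw [stableRayDeriv, norm_mul, norm_mul, hn, one_mul, mul_comm]
  refine mul_le_mul ?_ (norm_stableRay_le ha0 ha hu h0 h1 hr) (norm_nonneg _) (by positivity)
  refine (norm_add_le _ _).trans ?_
  rw [norm_neg, Complex.norm_I, add_assoc]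
  refine add_le_add le_rfl ((norm_add_le _ _).trans (add_le_add ?_ ?_))
  · rw [norm_mul, hn, norm_neg, Complex.norm_real, Real.norm_of_nonneg (by positivity), mul_one]
  · rw [norm_mul, hn, norm_mul, norm_mul, Complex.norm_I, Complex.norm_real, Complex.norm_real,
      Real.norm_of_nonneg ha0.le, Real.norm_of_nonneg hra]
    nlinarith

theorem integrableOn_stableRay_bound {a : ℝ} (u : ℝ) (ha0 : 0 < a) (ha : a < 1 / 2) :
    IntegrableOn (fun r : ℝ => (1 + r * u + r ^ a) * Real.exp (-Real.cos (Real.pi * a) * r ^ a))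
      (Set.Ioi 0) := by
  have hκ : 0 < Real.cos (Real.pi * a) := by
    apply Real.cos_pos_of_mem_Ioo
    constructor <;> nlinarith [Real.pi_pos]
  have h0 := integrableOn_rpow_mul_exp_neg_mul_rpow_of_pos (q := 0) (by norm_num) hκ ha0
  have h1 := integrableOn_rpow_mul_exp_neg_mul_rpow_of_pos (q := 1) (by norm_num) hκ ha0
  have h2 := integrableOn_rpow_mul_exp_neg_mul_rpow_of_pos (q := a) (by linarith) hκ ha0
  refine ((h0.add (h1.const_mul u)).add h2).congr (ae_of_all _ fun r => ?_)
  simp only [Pi.add_apply, Real.rpow_zero, Real.rpow_one]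
  ring

theorem integrableOn_exp_neg_cos_mul_rpow {a : ℝ} (ha0 : 0 < a) (ha : a < 1 / 2) :
    IntegrableOn (fun r : ℝ => Real.exp (-Real.cos (Real.pi * a) * r ^ a)) (Set.Ioi 0) := by
  have hκ : 0 < Real.cos (Real.pi * a) := by
    apply Real.cos_pos_of_mem_Ioo
    constructor <;> nlinarith [Real.pi_pos]
  simpa using integrableOn_rpow_mul_exp_neg_mul_rpow_of_pos (q := 0) (by norm_num) hκ ha0

/-- Cauchy's theorem in differential form: for holomorphic `g`, the angular derivative of `e^(-iθ)
g(r e^(-iθ))` equals the radial derivative of `-i e^(-iθ) r g(r e^(-iθ))`. That primitive vanishes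
at `r = 0` and at infinity. -/
theorem integral_stableRayDeriv {a u θ : ℝ} (ha0 : 0 < a) (ha : a < 1 / 2) (hu : 0 < u)
    (h0 : 0 ≤ θ) (h1 : θ ≤ Real.pi / 2) :
    ∫ r in Set.Ioi 0, stableRayDeriv a u θ r = 0 := by
  have hκ : 0 < Real.cos (Real.pi * a) := by
    apply Real.cos_pos_of_mem_Ioo
    constructor <;> nlinarith [Real.pi_pos]
  have hcont : Continuous (fun r => stableRay a u θ r) := by
    unfold stableRay
    have : Continuous (fun r : ℝ => r ^ a) := Real.continuous_rpow_const ha0.le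
    fun_prop
  have key := integral_Ioi_of_hasDerivAt_of_tendsto
    (f := fun r : ℝ => -Complex.I * Complex.exp (-(θ * Complex.I)) * (r * stableRay a u θ r))
    (f' := fun r => stableRayDeriv a u θ r) (a := 0) (m := 0) ?_ ?_ ?_ ?_
  · simpa using key
  · exact Continuous.continuousWithinAt (by fun_prop)
  · intro r hr
    have hr : 0 < r := hr
    have hd := (((hasDerivAt_id r).ofReal_comp).mul (hasDerivAt_stableRay_radius a u θ hr)).const_mul
      (-Complex.I * Complex.exp (-(θ * Complex.I)))
    refine hd.congr_deriv ?_
    -- The angular derivative carries `r ^ a` and the radial one `r * r ^ (a - 1)`; this identifies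
    -- them.
    have hra : ((r ^ a : ℝ) : ℂ) = r * (r ^ (a - 1) : ℝ) := by
      rw [← Complex.ofReal_mul, ← Real.rpow_one_add' hr.le (by linarith)]; congr 2; ring
    simp only [stableRayDeriv, hra, id]
    push_cast
    linear_combination (Complex.exp (-(θ * Complex.I)) ^ 2 * stableRay a u θ r * r * u) *
      Complex.I_sq
  · refine Integrable.mono' (integrableOn_stableRay_bound u ha0 ha) ?_ ?_
    · have := measurable_stableRay a u θ
      unfold stableRayDeriv
      exact Measurable.aestronglyMeasurable (by fun_prop)
    · refine (ae_restrict_iff' measurableSet_Ioi).2 (ae_of_all _ fun r hr => ?_)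
      exact norm_stableRayDeriv_le ha0 ha hu h0 h1 (le_of_lt hr)
  · refine squeeze_zero_norm' ?_ (tendsto_mul_exp_neg_mul_rpow hκ ha0)
    filter_upwards [Filter.eventually_gt_atTop 0] with r hr
    rw [norm_mul, norm_mul, norm_mul, norm_neg, Complex.norm_I, ← neg_mul, ← Complex.ofReal_neg,
      Complex.norm_exp_ofReal_mul_I, Complex.norm_real, Real.norm_of_nonneg hr.le, one_mul,
      one_mul]
    exact mul_le_mul_of_nonneg_left (norm_stableRay_le ha0 ha hu h0 h1 hr.le) hr.le

/-- Rotation of the ray of integration by a right angle, for real parts. -/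
theorem re_integral_stableRay_zero {a u : ℝ} (ha0 : 0 < a) (ha : a < 1 / 2) (hu : 0 < u) :
    (∫ r in Set.Ioi 0, stableRay a u 0 r).re =
      (∫ r in Set.Ioi 0, -Complex.I * stableRay a u (Real.pi / 2) r).re := by
  have hπ := Real.pi_pos
  set F : ℝ → ℝ → ℂ := fun θ r => Complex.exp (-(θ * Complex.I)) * stableRay a u θ r with hF
  have hFm : ∀ θ, AEStronglyMeasurable (F θ) (volume.restrict (Set.Ioi 0)) := fun θ =>
    ((measurable_stableRay a u θ).const_mul _).aestronglyMeasurable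
  have hFb : ∀ θ ∈ Set.Icc 0 (Real.pi / 2), ∀ᵐ r ∂(volume.restrict (Set.Ioi (0:ℝ))),
      ‖F θ r‖ ≤ Real.exp (-Real.cos (Real.pi * a) * r ^ a) := by
    intro θ hθ
    refine (ae_restrict_iff' measurableSet_Ioi).2 (ae_of_all _ fun r hr => ?_)
    rw [hF]
    simp only
    rw [norm_mul, ← neg_mul, ← Complex.ofReal_neg, Complex.norm_exp_ofReal_mul_I, one_mul]
    exact norm_stableRay_le ha0 ha hu hθ.1 hθ.2 (le_of_lt hr)
  have hbi := integrableOn_exp_neg_cos_mul_rpow ha0 ha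
  have hFd : ∀ θ r, HasDerivAt (fun θ => F θ r) (stableRayDeriv a u θ r) θ := by
    intro θ r
    have h1 : HasDerivAt (fun θ : ℝ => Complex.exp (-(θ * Complex.I)))
        (Complex.exp (-(θ * Complex.I)) * (-(1 * Complex.I))) θ :=
      ((((hasDerivAt_id θ).ofReal_comp).mul_const Complex.I).neg).cexp
    refine (h1.mul (hasDerivAt_stableRay_angle a u θ r)).congr_deriv ?_
    simp only [stableRayDeriv]
    ring
  have hcont : ContinuousOn (fun θ => ∫ r in Set.Ioi 0, F θ r) (Set.Icc 0 (Real.pi / 2)) :=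
    continuousOn_of_dominated (fun θ _ => hFm θ) hFb hbi
      (ae_of_all _ fun r => (continuous_iff_continuousAt.2 fun θ =>
        (hFd θ r).continuousAt).continuousOn)
  have hderiv : ∀ θ ∈ Set.Ioo 0 (Real.pi / 2),
      HasDerivAt (fun θ => ∫ r in Set.Ioi 0, F θ r) 0 θ := by
    intro θ hθ
    have h := hasDerivAt_integral_of_dominated_loc_of_deriv_le
      (μ := volume.restrict (Set.Ioi (0:ℝ))) (F := F) (F' := fun θ r => stableRayDeriv a u θ r)
      (x₀ := θ) (s := Set.Ioo 0 (Real.pi / 2)) (Ioo_mem_nhds hθ.1 hθ.2)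
      (Filter.Eventually.of_forall hFm)
      (Integrable.mono' hbi (hFm θ) (hFb θ (Set.Ioo_subset_Icc_self hθ)))
      (by
        have := measurable_stableRay a u θ
        unfold stableRayDeriv
        exact Measurable.aestronglyMeasurable (by fun_prop))
      ((ae_restrict_iff' measurableSet_Ioi).2 (ae_of_all _ fun r hr t ht =>
        norm_stableRayDeriv_le ha0 ha hu ht.1.le ht.2.le (le_of_lt hr)))
      (integrableOn_stableRay_bound u ha0 ha)
      (ae_of_all _ fun r t _ => hFd t r)
    rw [integral_stableRayDeriv ha0 ha hu hθ.1.le hθ.2.le] at h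
    exact h.2
  -- The mean value theorem needs a real function, hence the restriction to real parts. The
  -- endpoints are reached by continuity alone, as the bounds hold only on the closed quarter turn.
  obtain ⟨c, hc, h⟩ := exists_hasDerivAt_eq_slope
    (fun θ => (∫ r in Set.Ioi 0, F θ r).re) (fun _ => 0) (half_pos hπ)
    (Complex.continuous_re.comp_continuousOn hcont)
    (fun θ hθ => (Complex.reCLM.hasFDerivAt.comp_hasDerivAt θ (hderiv θ hθ)).congr_deriv (by simp))
  have h2 : (∫ r in Set.Ioi 0, F (Real.pi / 2) r).re = (∫ r in Set.Ioi 0, F 0 r).re := by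
    have : Real.pi / 2 - 0 ≠ 0 := by linarith
    field_simp at h
    linarith
  have e0 : F 0 = stableRay a u 0 := by
    funext r; simp [hF]
  have e1 : F (Real.pi / 2) = fun r => -Complex.I * stableRay a u (Real.pi / 2) r := by
    funext r
    simp only [hF]
    congr 1
    push_cast
    rw [Complex.exp_neg, Complex.exp_pi_div_two_mul_I, Complex.inv_I]
  rw [e0, e1] at h2
  exact h2.symm

/-! ### The one-sided stable density as a Laplace-type integral -/

/-- With `a = α / 2`, the scale `c` is chosen so that `c ^ a = cos(π a / 2)`. Then `(c t) ^ a (1 - i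
tan(π a / 2))` collapses to `t ^ a e^(-iπa/2)`. -/
theorem oneSidedStable_integrand {α u t : ℝ} (hα0 : 0 < α) (hα1 : α < 1) (ht : 0 ≤ t) :
    Complex.exp (-(Complex.I * (t * u : ℝ))) *
      stableCharFun (α / 2) 1 (Real.cos (α * Real.pi / 4) ^ (2 / α)) 0 t =
      stableRay (α / 2) u 0 t := by
  rcases ht.eq_or_lt with rfl | ht
  · have : α / 2 ≠ 0 := by positivity
    simp [stableCharFun, stableRay, Real.zero_rpow this]
  have hπ := Real.pi_pos
  have hc : 0 < Real.cos (α * Real.pi / 4) := by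
    apply Real.cos_pos_of_mem_Ioo
    constructor <;> nlinarith
  have hca : |Real.cos (α * Real.pi / 4) ^ (2 / α) * t| ^ (α / 2) =
      Real.cos (α * Real.pi / 4) * t ^ (α / 2) := by
    rw [abs_of_pos (by positivity), Real.mul_rpow (by positivity) ht.le, ← Real.rpow_mul hc.le]
    congr 1
    rw [show 2 / α * (α / 2) = 1 by field_simp, Real.rpow_one]
  have he : Real.pi * (α / 2) / 2 = α * Real.pi / 4 := by ring
  have hexp : ∀ x : ℝ, Complex.exp (-(x * Complex.I)) =
      (Real.cos (-x) : ℂ) + (Real.sin (-x) : ℂ) * Complex.I := by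
    intro x
    rw [← neg_mul, ← Complex.ofReal_neg, Complex.exp_ofReal_mul_I]
  rw [stableCharFun, stableRay, ← Complex.exp_add, hca, he, sign_pos ht, Real.tan_eq_sin_div_cos,
    hexp, hexp]
  congr 1
  have hc' : (Real.cos (α * Real.pi / 4) : ℂ) ≠ 0 := by exact_mod_cast hc.ne'
  have hm : (Real.cos (α * Real.pi / 4) : ℂ) *
      ((Real.sin (α * Real.pi / 4) / Real.cos (α * Real.pi / 4) : ℝ) : ℂ) =
      (Real.sin (α * Real.pi / 4) : ℂ) := by
    push_cast
    push_cast at hc'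
    field_simp
  simp only [neg_zero, Real.cos_zero, Real.sin_zero, zero_mul, SignType.coe_one, mul_zero,
    add_zero, Real.cos_neg, Real.sin_neg, one_mul, Complex.ofReal_zero, Complex.ofReal_neg,
    Complex.ofReal_one, Complex.ofReal_mul]
  linear_combination (Complex.I * ((t ^ (α / 2) : ℝ) : ℂ)) * hm

/-- Changing the sign of `t` conjugates the integrand, so the inversion integral has twice the real
part of its half-line version. -/
theorem re_oneSidedStable_integrand_neg (a c u t : ℝ) :
    (Complex.exp (-(Complex.I * (-t * u : ℝ))) * stableCharFun a 1 c 0 (-t)).re =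
      (Complex.exp (-(Complex.I * (t * u : ℝ))) * stableCharFun a 1 c 0 t).re := by
  rw [← Complex.conj_re]
  congr 1
  rw [map_mul, stableCharFun, stableCharFun, ← Complex.exp_conj, ← Complex.exp_conj]
  congr 2
  · simp
  · have h1 : |c * -t| = |c * t| := by rw [mul_neg, abs_neg]
    rw [h1, Left.sign_neg]
    simp only [mul_neg, map_sub, map_mul, map_one, Complex.conj_I, Complex.conj_ofReal,
      zero_mul, SignType.coe_neg, Complex.ofReal_neg, Complex.ofReal_mul, Complex.ofReal_zero, map_neg, map_zero]
    ring

theorem norm_oneSidedStable_integrand (a c u t : ℝ) :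
    ‖Complex.exp (-(Complex.I * (t * u : ℝ))) * stableCharFun a 1 c 0 t‖ =
      Real.exp (-|c * t| ^ a) := by
  rw [stableCharFun, ← Complex.exp_add, Complex.norm_exp]
  congr 1
  have : ∀ x y : ℝ, (Complex.I * (x : ℂ)).re = 0 ∧
      ((y : ℂ) * (1 - Complex.I * (x : ℂ))).re = y := by
    intro x y; simp
  rw [Complex.add_re, Complex.sub_re, Complex.neg_re, (this _ 0).1, (this _ 0).1, (this _ _).2]
  ring

/-- The integrand of the inversion formula is jointly measurable. -/
theorem measurable_stableIntegrand (a c : ℝ) :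
    Measurable (fun q : ℝ × ℝ => Complex.exp (-(Complex.I * (q.2 * q.1 : ℝ))) *
      stableCharFun a 1 c 0 q.2) := by
  have hs : Measurable (fun t : ℝ => ((SignType.sign t : SignType) : ℝ)) := by
    have : (fun t : ℝ => ((SignType.sign t : SignType) : ℝ)) =
        fun t => if 0 < t then 1 else if t < 0 then -1 else 0 := by
      funext t
      rw [sign_apply]
      split_ifs <;> simp
    rw [this]
    exact Measurable.ite measurableSet_Ioi measurable_const
      (Measurable.ite measurableSet_Iio measurable_const measurable_const)
  have hm : Measurable (stableCharFun a 1 c 0) := by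
    unfold stableCharFun
    fun_prop
  fun_prop

theorem integrable_oneSidedStable_integrand {α : ℝ} (hα0 : 0 < α) (hα1 : α < 1) (u : ℝ) :
    Integrable (fun t : ℝ => Complex.exp (-(Complex.I * (t * u : ℝ))) *
      stableCharFun (α / 2) 1 (Real.cos (α * Real.pi / 4) ^ (2 / α)) 0 t) := by
  have hc : 0 < Real.cos (α * Real.pi / 4) := by
    apply Real.cos_pos_of_mem_Ioo
    constructor <;> nlinarith [Real.pi_pos]
  set c := Real.cos (α * Real.pi / 4) ^ (2 / α) with hcd
  have hc0 : 0 < c := by positivity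
  have hb : Integrable (fun t : ℝ => Real.exp (-|c * t| ^ (α / 2))) := by
    have h0 : IntegrableOn (fun t : ℝ => Real.exp (-|c * t| ^ (α / 2))) (Set.Ioi 0) := by
      have h := integrableOn_rpow_mul_exp_neg_mul_rpow_of_pos (q := 0) (b := c ^ (α / 2))
        (a := α / 2) (by norm_num) (by positivity) (by positivity)
      refine h.congr_fun (fun t ht => ?_) measurableSet_Ioi
      have ht : 0 < t := ht
      simp only
      rw [abs_of_pos (by positivity), Real.mul_rpow hc0.le ht.le, Real.rpow_zero, one_mul, neg_mul]
    have h1 := (integrable_indicator_iff measurableSet_Ioi).2 h0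
    -- By evenness, the function is the sum of its restriction to the positive half-line and the
    -- reflection of that restriction, off the null set `{0}`.
    refine (h1.add h1.comp_neg).congr ?_
    have hne : ∀ᵐ t : ℝ, t ≠ 0 := by simp [ae_iff]
    filter_upwards [hne] with t ht
    rcases lt_or_gt_of_ne ht with h | h
    · simp [Set.indicator, h, h.le]
    · simp [Set.indicator, h, h.le]
  refine hb.mono' ((measurable_stableIntegrand (α / 2) c).comp
    (measurable_const.prodMk measurable_id)).aestronglyMeasurable (ae_of_all _ fun t => (norm_oneSidedStable_integrand _ _ _ _).le)

/-- On the rotated ray the oscillating factor `e^(-iru)` becomes the decaying `e^(-ur)`, so the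
behaviour for large `u` is governed by the remaining factor near `r = 0`. -/
theorem oneSidedStableDensity_eq {α u : ℝ} (hα0 : 0 < α) (hα1 : α < 1) (hu : 0 < u) :
    oneSidedStableDensity α u = Real.pi⁻¹ * ∫ r in Set.Ioi 0,
      (Complex.exp (-(r ^ (α / 2) : ℝ) *
        Complex.exp (-((Real.pi * (α / 2) : ℝ) * Complex.I)))).im * Real.exp (-(u * r)) := by
  have ha0 : 0 < α / 2 := by positivity
  have ha : α / 2 < 1 / 2 := by linarith
  have hint := integrable_oneSidedStable_integrand hα0 hα1 u
  set f : ℝ → ℂ := fun t => Complex.exp (-(Complex.I * (t * u : ℝ))) *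
      stableCharFun (α / 2) 1 (Real.cos (α * Real.pi / 4) ^ (2 / α)) 0 t with hf
  have h1 : (∫ t, f t).re = 2 * (∫ r in Set.Ioi 0, stableRay (α / 2) u 0 r).re := by
    have e1 : (∫ t, f t).re = ∫ t, (f t).re := Complex.reCLM.integral_comp_comm hint |>.symm
    have e2 : (∫ r in Set.Ioi 0, f r).re = ∫ r in Set.Ioi 0, (f r).re :=
      Complex.reCLM.integral_comp_comm hint.integrableOn |>.symm
    have e3 : ∫ r in Set.Ioi 0, stableRay (α / 2) u 0 r = ∫ r in Set.Ioi 0, f r :=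
      setIntegral_congr_fun measurableSet_Ioi fun t ht =>
        (oneSidedStable_integrand hα0 hα1 (le_of_lt ht)).symm
    rw [e3, e1, e2, ← integral_comp_abs]
    congr 1
    funext t
    rcases abs_choice t with h | h
    · rw [h]
    · rw [h]; exact (re_oneSidedStable_integrand_neg _ _ _ _).symm
  have h2 : (∫ r in Set.Ioi 0, -Complex.I * stableRay (α / 2) u (Real.pi / 2) r).re =
      ∫ r in Set.Ioi 0, (-Complex.I * stableRay (α / 2) u (Real.pi / 2) r).re := by
    refine (Complex.reCLM.integral_comp_comm ?_).symm
    refine Integrable.mono' (integrableOn_exp_neg_cos_mul_rpow ha0 ha)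
      ((measurable_stableRay _ _ _).const_mul _).aestronglyMeasurable ?_
    refine (ae_restrict_iff' measurableSet_Ioi).2 (ae_of_all _ fun r hr => ?_)
    rw [norm_mul, norm_neg, Complex.norm_I, one_mul]
    exact norm_stableRay_le ha0 ha hu (by positivity) le_rfl (le_of_lt hr)
  rw [oneSidedStableDensity, stableDensity, h1, re_integral_stableRay_zero ha0 ha hu, h2, mul_inv,
    show ∀ x : ℝ, 2⁻¹ * Real.pi⁻¹ * (2 * x) = Real.pi⁻¹ * x by intro x; ring]
  congr 1
  refine setIntegral_congr_fun measurableSet_Ioi fun r hr => ?_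
  have : stableRay (α / 2) u (Real.pi / 2) r = Complex.exp (-(r ^ (α / 2) : ℝ) *
        Complex.exp (-((Real.pi * (α / 2) : ℝ) * Complex.I))) * (Real.exp (-(u * r)) : ℝ) := by
    rw [stableRay, Complex.ofReal_exp, ← Complex.exp_add]
    congr 1
    have : Complex.exp (-((Real.pi / 2 : ℝ) * Complex.I)) = -Complex.I := by
      push_cast
      rw [Complex.exp_neg, Complex.exp_pi_div_two_mul_I, Complex.inv_I]
    rw [this]
    have e : Real.pi * (α / 2) / 2 + α / 2 * (Real.pi / 2) = Real.pi * (α / 2) := by ring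
    rw [e]
    push_cast
    linear_combination (r * u : ℂ) * Complex.I_sq
  rw [this]
  simp only [Complex.mul_re, Complex.neg_re, Complex.neg_im, Complex.I_re, Complex.I_im,
    Complex.mul_im, Complex.ofReal_re, Complex.ofReal_im]
  ring

/-- Watson's lemma to first order: in `Im exp(w)` the constant term drops out, the linear term is
`r^(α/2) sin(πα/2)`, and the remainder is at most `3 r^α`. Integration against `e^(-ur)` turns these
powers into Gamma values. -/
theorem exists_oneSidedStableDensity_asymptotics {α : ℝ} (hα0 : 0 < α) (hα1 : α < 1) :
    ∃ A B : ℝ, 0 < A ∧ 0 < B ∧ ∀ u > 0,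
      |oneSidedStableDensity α u - A * u⁻¹ ^ (1 + α / 2)| ≤ B * u⁻¹ ^ (1 + α) := by
  have hπ := Real.pi_pos
  have hs : 0 < Real.sin (Real.pi * (α / 2)) := by
    apply Real.sin_pos_of_pos_of_lt_pi <;> nlinarith
  have hκ : 0 < Real.cos (Real.pi * (α / 2)) := by
    apply Real.cos_pos_of_mem_Ioo
    constructor <;> nlinarith
  have g1 : 0 < Real.Gamma (1 + α / 2) := Real.Gamma_pos_of_pos (by positivity)
  have g2 : 0 < Real.Gamma (1 + α) := Real.Gamma_pos_of_pos (by positivity)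
  refine ⟨Real.pi⁻¹ * Real.sin (Real.pi * (α / 2)) * Real.Gamma (1 + α / 2),
    Real.pi⁻¹ * 3 * Real.Gamma (1 + α), by positivity, by positivity, fun u hu => ?_⟩
  have hI : ∀ q : ℝ, 0 < q → IntegrableOn (fun r : ℝ => r ^ q * Real.exp (-(u * r))) (Set.Ioi 0) := by
    intro q hq
    simpa using integrableOn_rpow_mul_exp_neg_mul_rpow_of_pos (q := q) (by linarith) hu one_pos
  have hv : ∀ q : ℝ, 0 < q → ∫ r in Set.Ioi 0, r ^ q * Real.exp (-(u * r)) =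
      u⁻¹ ^ (1 + q) * Real.Gamma (1 + q) := by
    intro q hq
    have := Real.integral_rpow_mul_exp_neg_mul_Ioi (a := 1 + q) (by positivity) hu
    rw [one_div] at this
    rw [← this]
    simp
  set w : ℝ → ℂ := fun r => -(r ^ (α / 2) : ℝ) *
    Complex.exp (-((Real.pi * (α / 2) : ℝ) * Complex.I)) with hw
  have hwexp : Complex.exp (-((Real.pi * (α / 2) : ℝ) * Complex.I)) =
      Complex.exp ((-(Real.pi * (α / 2)) : ℝ) * Complex.I) := by
    rw [Complex.ofReal_neg, neg_mul]
  have hwre : ∀ r, (w r).re = -(r ^ (α / 2) * Real.cos (Real.pi * (α / 2))) := by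
    intro r
    simp only [hw, hwexp, Complex.mul_re, Complex.neg_re, Complex.neg_im, Complex.ofReal_re,
      Complex.ofReal_im, Complex.exp_ofReal_mul_I_re, Complex.exp_ofReal_mul_I_im, Real.cos_neg]
    ring
  have hwim : ∀ r, (w r).im = r ^ (α / 2) * Real.sin (Real.pi * (α / 2)) := by
    intro r
    simp only [hw, hwexp, Complex.mul_im, Complex.neg_re, Complex.neg_im, Complex.ofReal_re,
      Complex.ofReal_im, Complex.exp_ofReal_mul_I_re, Complex.exp_ofReal_mul_I_im, Real.sin_neg]
    ring
  have hwn : ∀ r : ℝ, 0 < r → ‖w r‖ ^ 2 = r ^ α := by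
    intro r hr
    simp only [hw, hwexp]
    rw [norm_mul, Complex.norm_exp_ofReal_mul_I, mul_one, norm_neg, Complex.norm_real,
      Real.norm_of_nonneg (by positivity), ← Real.rpow_natCast, ← Real.rpow_mul hr.le]
    congr 1
    push_cast
    ring
  have hbd : ∀ r : ℝ, 0 < r →
      |(Complex.exp (w r)).im - r ^ (α / 2) * Real.sin (Real.pi * (α / 2))| ≤ 3 * r ^ α := by
    intro r hr
    have h := Complex.norm_exp_sub_one_sub_id_le_of_re_nonpos (z := w r) (by
      rw [hwre]; exact neg_nonpos.2 (by positivity))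
    rw [hwn r hr] at h
    refine le_trans ?_ ((Complex.abs_im_le_norm _).trans h)
    simp [hwim]
  have hwm : Measurable w := by simp only [hw]; fun_prop
  have hJ : IntegrableOn (fun r : ℝ => (Complex.exp (w r)).im * Real.exp (-(u * r)) -
      r ^ (α / 2) * Real.sin (Real.pi * (α / 2)) * Real.exp (-(u * r))) (Set.Ioi 0) := by
    refine Integrable.mono' ((hI α hα0).const_mul 3) ?_ ?_
    · have : Measurable fun r : ℝ => (Complex.exp (w r)).im :=
        Complex.measurable_im.comp (Complex.measurable_exp.comp hwm)
      exact Measurable.aestronglyMeasurable (by fun_prop)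
    · refine (ae_restrict_iff' measurableSet_Ioi).2 (ae_of_all _ fun r hr => ?_)
      rw [← sub_mul, norm_mul, Real.norm_of_nonneg (Real.exp_pos _).le, Real.norm_eq_abs,
        ← mul_assoc]
      exact mul_le_mul_of_nonneg_right (hbd r hr) (Real.exp_pos _).le
  have hK : IntegrableOn (fun r : ℝ =>
      r ^ (α / 2) * Real.sin (Real.pi * (α / 2)) * Real.exp (-(u * r))) (Set.Ioi 0) := by
    refine ((hI (α / 2) (by positivity)).const_mul (Real.sin (Real.pi * (α / 2)))).congr
      (ae_of_all _ fun r => ?_)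
    simp only
    ring
  have hKv : ∫ r in Set.Ioi 0, r ^ (α / 2) * Real.sin (Real.pi * (α / 2)) * Real.exp (-(u * r)) =
      Real.sin (Real.pi * (α / 2)) * (u⁻¹ ^ (1 + α / 2) * Real.Gamma (1 + α / 2)) := by
    rw [← hv _ (by positivity), ← integral_const_mul]
    congr 1
    funext r
    ring
  have hsplit : ∫ r in Set.Ioi 0, (Complex.exp (w r)).im * Real.exp (-(u * r)) =
      (∫ r in Set.Ioi 0, ((Complex.exp (w r)).im * Real.exp (-(u * r)) -
        r ^ (α / 2) * Real.sin (Real.pi * (α / 2)) * Real.exp (-(u * r)))) +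
      ∫ r in Set.Ioi 0, r ^ (α / 2) * Real.sin (Real.pi * (α / 2)) * Real.exp (-(u * r)) := by
    rw [← integral_add hJ hK]
    simp
  have hJb : |∫ r in Set.Ioi 0, ((Complex.exp (w r)).im * Real.exp (-(u * r)) -
        r ^ (α / 2) * Real.sin (Real.pi * (α / 2)) * Real.exp (-(u * r)))| ≤
      3 * (u⁻¹ ^ (1 + α) * Real.Gamma (1 + α)) := by
    rw [← hv _ hα0, ← integral_const_mul, ← Real.norm_eq_abs]
    refine norm_integral_le_of_norm_le ((hI α hα0).const_mul 3) ?_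
    refine (ae_restrict_iff' measurableSet_Ioi).2 (ae_of_all _ fun r hr => ?_)
    rw [← sub_mul, norm_mul, Real.norm_of_nonneg (Real.exp_pos _).le, Real.norm_eq_abs,
      ← mul_assoc]
    exact mul_le_mul_of_nonneg_right (hbd r hr) (Real.exp_pos _).le
  rw [oneSidedStableDensity_eq hα0 hα1 hu, hsplit, hKv]
  rw [show ∀ j x y z : ℝ, Real.pi⁻¹ * (j + x * (y * z)) - Real.pi⁻¹ * x * z * y = Real.pi⁻¹ * j by
    intros; ring, abs_mul, abs_of_pos (inv_pos.2 hπ)]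
  calc _ ≤ Real.pi⁻¹ * (3 * (u⁻¹ ^ (1 + α) * Real.Gamma (1 + α))) := by gcongr
    _ = _ := by ring

theorem measurable_oneSidedStableDensity (α : ℝ) : Measurable (oneSidedStableDensity α) := by
  have h := (measurable_stableIntegrand (α / 2)
    (Real.cos (α * Real.pi / 4) ^ (2 / α))).stronglyMeasurable.integral_prod_right'
    (ν := (volume : Measure ℝ))
  unfold oneSidedStableDensity stableDensity
  exact (Complex.measurable_re.comp h.measurable).const_mul _

/-- The modulus of the inversion integrand does not depend on `u`. -/
theorem exists_abs_oneSidedStableDensity_le (α : ℝ) :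
    ∃ C : ℝ, 0 ≤ C ∧ ∀ u, |oneSidedStableDensity α u| ≤ C := by
  refine ⟨|(2 * Real.pi)⁻¹| * ∫ t : ℝ, Real.exp
    (-|Real.cos (α * Real.pi / 4) ^ (2 / α) * t| ^ (α / 2)), by positivity, fun u => ?_⟩
  rw [oneSidedStableDensity, stableDensity, abs_mul]
  gcongr
  refine (Complex.abs_re_le_norm _).trans ((norm_integral_le_integral_norm _).trans ?_)
  simp_rw [norm_oneSidedStable_integrand]
  rfl

/-! ### Uniform ergodicity from a minorization condition -/

/-- One step of a chain contracts the range of a function of `f x` if the law of `f` after one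
step is minorized. -/
theorem exists_integral_mem_Icc_of_minorization {S T : Type*} [MeasurableSpace S]
    [MeasurableSpace T] (P : Kernel S S) [IsMarkovKernel P] {f : S → T} (hf : Measurable f)
    (ν : Measure T) [IsProbabilityMeasure ν] {δ : ℝ} (hδ : 0 ≤ δ)
    (hmin : ∀ x A, MeasurableSet A → ENNReal.ofReal δ * ν A ≤ P x (f ⁻¹' A))
    {h : T → ℝ} (hh : Measurable h) {a w : ℝ} (hlo : ∀ t, a ≤ h t) (hhi : ∀ t, h t ≤ a + w) :
    ∃ b, ∀ x, b ≤ ∫ y, h (f y) ∂(P x) ∧ ∫ y, h (f y) ∂(P x) ≤ b + (1 - δ) * w := by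
  have hb : ∀ t, ‖h t‖ ≤ |a| + |w| := by
    intro t
    rw [Real.norm_eq_abs, abs_le]
    constructor
    · linarith [hlo t, neg_abs_le a, abs_nonneg w]
    · linarith [hhi t, le_abs_self a, le_abs_self w]
  have hint : ∀ (μ : Measure T) [IsFiniteMeasure μ], Integrable h μ := fun μ _ =>
    Integrable.of_bound hh.aestronglyMeasurable _ (ae_of_all _ hb)
  have hle : ∀ x, ENNReal.ofReal δ • ν ≤ (P x).map f := by
    intro x
    refine Measure.le_iff.2 fun A hA => ?_
    rw [Measure.map_apply hf hA, Measure.smul_apply, smul_eq_mul]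
    exact hmin x A hA
  have hmono : ∀ x, ∀ k : T → ℝ, Measurable k → (∀ t, 0 ≤ k t) → (∀ t, k t ≤ w) →
      δ * ∫ t, k t ∂ν ≤ ∫ y, k (f y) ∂(P x) := by
    intro x k hk h0 h1
    have : IsProbabilityMeasure ((P x).map f) := Measure.isProbabilityMeasure_map hf.aemeasurable
    have hki : Integrable k ((P x).map f) :=
      Integrable.of_bound hk.aestronglyMeasurable w (ae_of_all _ fun t => by
        rw [Real.norm_of_nonneg (h0 t)]; exact h1 t)
    rw [← integral_map hf.aemeasurable hk.aestronglyMeasurable]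
    have := integral_mono_measure (hle x) (ae_of_all _ h0) hki
    rwa [integral_smul_measure, ENNReal.toReal_ofReal hδ, smul_eq_mul] at this
  -- The minorized part contributes the same amount from every `x`. Applying `hmono` to `h - a`
  -- gives the lower bound, and to `a + w - h` the upper one.
  refine ⟨a + δ * ∫ t, (h t - a) ∂ν, fun x => ?_⟩
  have hP : Integrable (fun y => h (f y)) (P x) :=
    Integrable.of_bound (hh.comp hf).aestronglyMeasurable _ (ae_of_all _ fun y => hb (f y))
  have h1 := hmono x (fun t => h t - a) (by fun_prop) (fun t => by linarith [hlo t])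
    (fun t => by linarith [hhi t])
  have h2 := hmono x (fun t => a + w - h t) (by fun_prop) (fun t => by linarith [hhi t])
    (fun t => by linarith [hlo t])
  rw [integral_sub hP (integrable_const _)] at h1
  rw [integral_sub (integrable_const _) hP, integral_sub (integrable_const _) (hint ν)] at h2
  rw [integral_sub (hint ν) (integrable_const _)] at h1 ⊢
  simp only [integral_const, probReal_univ, one_smul] at h1 h2 ⊢
  constructor <;> linarith

theorem isMarkovKernel_pow {S : Type*} [MeasurableSpace S] (P : Kernel S S) [IsMarkovKernel P]
    (n : ℕ) : IsMarkovKernel (P ^ n) := by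
  induction n with
  | zero => rw [pow_zero]; exact inferInstanceAs (IsMarkovKernel Kernel.id)
  | succ n ih => rw [pow_succ]; exact inferInstanceAs (IsMarkovKernel ((P ^ n) ∘ₖ P))

/-- Chapman–Kolmogorov split at the first step, the form in which one application of `P` averages
the function `y ↦ Pⁿ(y, A)`. -/
theorem measureReal_kernel_pow_succ {S : Type*} [MeasurableSpace S] (P : Kernel S S)
    [IsMarkovKernel P] (n : ℕ) (x : S) {A : Set S} (hA : MeasurableSet A) :
    ((P ^ (n + 1)) x).real A = ∫ y, ((P ^ n) y).real A ∂(P x) := by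
  have hn := isMarkovKernel_pow P n
  have h : (P ^ (n + 1)) x A = ∫⁻ y, (P ^ n) y A ∂(P x) := by
    rw [pow_succ]
    exact Kernel.comp_apply' _ _ _ hA
  rw [Measure.real, h, ← integral_toReal]
  · rfl
  · exact (Kernel.measurable_coe _ hA).aemeasurable
  · exact ae_of_all _ fun y => measure_lt_top _ _

/-- Doeblin's argument, with the minorization assumed only for the image under `f`. This suffices
because `P x` depends on `x` only through `f x`: after one step `x ↦ Pⁿ(x, A)` is a function of `f
x`, and each further step shrinks its range by `1 - δ`. Averaging over `π` places `π(A)` in that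
range. -/
theorem uniformlyErgodic_of_minorization {S T : Type*} [MeasurableSpace S] [MeasurableSpace T]
    (P : Kernel S S) [IsMarkovKernel P] (π : Measure S) [IsProbabilityMeasure π]
    (hinv : P.Invariant π) {f : S → T} {g : T → S} (hf : Measurable f) (hg : Measurable g)
    (hP : ∀ x, P (g (f x)) = P x) (ν : Measure T) [IsProbabilityMeasure ν] {δ : ℝ} (hδ : 0 < δ)
    (hmin : ∀ x A, MeasurableSet A → ENNReal.ofReal δ * ν A ≤ P x (f ⁻¹' A)) :
    UniformlyErgodic P π := by
  have hM : ∀ n : ℕ, IsMarkovKernel (P ^ n) := fun n => isMarkovKernel_pow P n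
  have hδ1 : δ ≤ 1 := by
    obtain ⟨x⟩ : Nonempty S := π.nonempty_of_neZero
    have := hmin x Set.univ MeasurableSet.univ
    rw [measure_univ, mul_one, Set.preimage_univ, measure_univ] at this
    exact ENNReal.ofReal_le_one.1 this
  have hinvn : ∀ n : ℕ, (P ^ n).Invariant π := by
    intro n
    induction n with
    | zero =>
      rw [pow_zero]
      exact Measure.bind_dirac
    | succ n ih => rw [pow_succ]; exact ih.comp hinv
  -- The powers start at one: `P ^ 0` need not factor through `f`.
  have hosc : ∀ (n : ℕ) (A : Set S), MeasurableSet A →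
      ∃ b : ℝ, ∀ x, b ≤ ((P ^ (n + 1)) x).real A ∧ ((P ^ (n + 1)) x).real A ≤ b + (1 - δ) ^ n := by
    intro n A hA
    induction n with
    | zero =>
      refine ⟨0, fun x => ⟨measureReal_nonneg, ?_⟩⟩
      rw [pow_zero (1 - δ), zero_add (1 : ℝ)]
      exact measureReal_le_one (μ := (P ^ (0 + 1)) x)
    | succ n ih =>
      obtain ⟨a, ha⟩ := ih
      have hgf : ∀ y, ((P ^ (n + 1)) (g (f y))).real A = ((P ^ (n + 1)) y).real A := by
        intro y
        rw [measureReal_kernel_pow_succ P n _ hA, hP, ← measureReal_kernel_pow_succ P n _ hA]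
      obtain ⟨b, hb⟩ := exists_integral_mem_Icc_of_minorization P hf ν hδ.le hmin
        (h := fun t => ((P ^ (n + 1)) (g t)).real A)
        (((Kernel.measurable_coe (P ^ (n + 1)) hA).comp hg).ennreal_toReal)
        (fun t => (ha _).1) (fun t => (ha _).2)
      refine ⟨b, fun x => ?_⟩
      rw [measureReal_kernel_pow_succ P (n + 1) x hA, pow_succ' (1 - δ)]
      simpa only [hgf] using hb x
  have hdist : ∀ (n : ℕ) (x : S) (A : Set S), MeasurableSet A →
      |((P ^ (n + 1)) x).real A - π.real A| ≤ (1 - δ) ^ n := by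
    intro n x A hA
    obtain ⟨b, hb⟩ := hosc n A hA
    have hπ : π.real A = ∫ y, ((P ^ (n + 1)) y).real A ∂π := by
      conv_lhs => rw [Measure.real, ← (hinvn (n + 1)).def,
        Measure.bind_apply hA (Kernel.aemeasurable _), ← integral_toReal
          (Kernel.measurable_coe _ hA).aemeasurable (ae_of_all _ fun y => measure_lt_top _ _)]
      rfl
    have hi : Integrable (fun y => ((P ^ (n + 1)) y).real A) π :=
      Integrable.of_bound (Kernel.measurable_coe _ hA).ennreal_toReal.aestronglyMeasurable 1
        (ae_of_all _ fun y => by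
          rw [Real.norm_of_nonneg measureReal_nonneg]; exact measureReal_le_one)
    have h1 : b ≤ π.real A := by
      rw [hπ]
      have := integral_mono (integrable_const b) hi fun y => (hb y).1
      simpa using this
    have h2 : π.real A ≤ b + (1 - δ) ^ n := by
      rw [hπ]
      have := integral_mono hi (integrable_const (b + (1 - δ) ^ n)) fun y => (hb y).2
      simpa using this
    rw [abs_le]
    constructor <;> linarith [(hb x).1, (hb x).2]
  -- The bound `(1 - δ) ^ n` holds for the power `n + 1`. As `δ ≤ 1`, one has `2 (1 - δ / 2) ≥ 1`,
  -- which absorbs the shift even when `δ = 1`, where the rate `1 - δ` would be zero.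
  refine ⟨inferInstance, inferInstance, hinv, 2, 1 - δ / 2, by linarith, by linarith, ?_⟩
  intro n x A hA
  rcases n with _ | n
  · have h1 : 0 ≤ ((P ^ 0) x).real A := measureReal_nonneg
    have h2 : ((P ^ 0) x).real A ≤ 1 := measureReal_le_one
    have h3 : 0 ≤ π.real A := measureReal_nonneg
    have h4 : π.real A ≤ 1 := measureReal_le_one
    rw [pow_zero (1 - δ / 2), abs_le]
    constructor <;> linarith
  · refine (hdist n x A hA).trans ?_
    have h1 : (1 - δ) ^ n ≤ (1 - δ / 2) ^ n := pow_le_pow_left₀ (by linarith) (by linarith) n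
    have h2 : 0 ≤ (1 - δ / 2) ^ n := pow_nonneg (by linarith) n
    rw [pow_succ]
    nlinarith

/-! ### The Gaussian scale mixture -/

/-- Chebyshev's integral inequality for similarly ordered functions. -/
theorem lintegral_mul_lintegral_le_of_comonotone {S : Type*} [MeasurableSpace S] (μ : Measure S)
    {f g : S → ℝ} (hf : Measurable f) (hg : Measurable g) (hf0 : ∀ x, 0 ≤ f x)
    (hg0 : ∀ x, 0 ≤ g x) (hfg : ∀ x y, 0 ≤ (f x - f y) * (g x - g y)) :
    (∫⁻ x, ENNReal.ofReal (f x) ∂μ) * ∫⁻ x, ENNReal.ofReal (g x) ∂μ ≤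
      (∫⁻ x, ENNReal.ofReal (f x * g x) ∂μ) * μ Set.univ := by
  set F : S → ℝ≥0∞ := fun x => ENNReal.ofReal (f x) with hF
  set G : S → ℝ≥0∞ := fun x => ENNReal.ofReal (g x) with hG
  set H : S → ℝ≥0∞ := fun x => ENNReal.ofReal (f x * g x) with hH
  have hFm : Measurable F := by fun_prop
  have hGm : Measurable G := by fun_prop
  have hHm : Measurable H := by fun_prop
  -- The inequality `(f x - f y)(g x - g y) ≥ 0` is written without subtraction, so it can be
  -- integrated twice in `ℝ≥0∞` without any integrability assumption.
  have key : ∀ x y, F x * G y + F y * G x ≤ H x + H y := by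
    intro x y
    simp only [hF, hG, hH]
    rw [← ENNReal.ofReal_mul (hf0 x), ← ENNReal.ofReal_mul (hf0 y),
      ← ENNReal.ofReal_add (mul_nonneg (hf0 x) (hg0 y)) (mul_nonneg (hf0 y) (hg0 x)),
      ← ENNReal.ofReal_add (mul_nonneg (hf0 x) (hg0 x)) (mul_nonneg (hf0 y) (hg0 y))]
    exact ENNReal.ofReal_le_ofReal (by nlinarith [hfg x y])
  have h1 : ∫⁻ x, ∫⁻ y, (F x * G y + F y * G x) ∂μ ∂μ =
      2 * ((∫⁻ x, F x ∂μ) * ∫⁻ x, G x ∂μ) := by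
    have : ∀ x, ∫⁻ y, (F x * G y + F y * G x) ∂μ =
        F x * (∫⁻ y, G y ∂μ) + (∫⁻ y, F y ∂μ) * G x := by
      intro x
      rw [lintegral_add_left (by fun_prop), lintegral_const_mul _ hGm, lintegral_mul_const _ hFm]
    simp_rw [this]
    rw [lintegral_add_left (by fun_prop), lintegral_mul_const _ hFm, lintegral_const_mul _ hGm,
      two_mul]
  have h2 : ∫⁻ x, ∫⁻ y, (H x + H y) ∂μ ∂μ = 2 * ((∫⁻ x, H x ∂μ) * μ Set.univ) := by
    have : ∀ x, ∫⁻ y, (H x + H y) ∂μ = H x * μ Set.univ + ∫⁻ y, H y ∂μ := by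
      intro x
      rw [lintegral_add_left (by fun_prop), lintegral_const]
    simp_rw [this]
    rw [lintegral_add_left (by fun_prop), lintegral_mul_const _ hHm, lintegral_const, two_mul]
  have h3 := lintegral_mono (μ := μ) fun x => lintegral_mono (μ := μ) fun y => key x y
  rw [h1, h2] at h3
  exact (ENNReal.mul_le_mul_iff_right two_ne_zero ENNReal.ofNat_ne_top).1 h3

/-! ### The mixing measure and its Laplace transform -/

@[fun_prop]
theorem measurable_bridgeLocalDensity (α : ℝ) : Measurable (bridgeLocalDensity α) := by
  have h := measurable_oneSidedStableDensity α
  have h2 : Measurable fun l : ℝ => l ^ (-2 : ℤ) := by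
    simp only [zpow_neg]
    fun_prop
  unfold bridgeLocalDensity
  exact (h2.mul (h.comp (h2.div_const 2))).ennreal_ofReal

/-- Mixing measure of the bridge prior as a mixture of centered Gaussian kernels in `1 / l`. -/
noncomputable def bridgeMixing (α : ℝ) : Measure ℝ :=
  (volume.restrict (Set.Ioi 0)).withDensity fun l => ENNReal.ofReal l⁻¹ * bridgeLocalDensity α l

/-- The Laplace transform, in the precision `1 / (2 l²)`, of the mixing measure. -/
noncomputable def bridgeMix (α s : ℝ) : ℝ≥0∞ :=
  ∫⁻ l, ENNReal.ofReal (Real.exp (-(s / (2 * l ^ 2)))) ∂(bridgeMixing α)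

theorem bridgeMix_antitone (α : ℝ) {s t : ℝ} (h : s ≤ t) : bridgeMix α t ≤ bridgeMix α s := by
  refine lintegral_mono fun l => ENNReal.ofReal_le_ofReal (Real.exp_le_exp.2 ?_)
  have : 0 ≤ 2 * l ^ 2 := by positivity
  exact neg_le_neg (div_le_div_of_nonneg_right h this)

theorem measurable_bridgeMix (α : ℝ) : Measurable (bridgeMix α) := by
  have : Antitone (bridgeMix α) := fun s t h => bridgeMix_antitone α h
  exact this.measurable

theorem bridgeMix_zero (α : ℝ) : bridgeMix α 0 = bridgeMixing α Set.univ := by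
  simp [bridgeMix]

/-- Both exponentials decrease in the precision `1 / (2 l²)`, so they are positively correlated
under the mixing measure. The minorization rests on this inequality. -/
theorem bridgeMix_mul_le (α : ℝ) {s t : ℝ} (hs : 0 ≤ s) (ht : 0 ≤ t) :
    bridgeMix α s * bridgeMix α t ≤ bridgeMix α (s + t) * bridgeMix α 0 := by
  have h := lintegral_mul_lintegral_le_of_comonotone (bridgeMixing α)
    (f := fun l => Real.exp (-(s / (2 * l ^ 2)))) (g := fun l => Real.exp (-(t / (2 * l ^ 2))))
    (by fun_prop) (by fun_prop) (fun _ => (Real.exp_pos _).le) (fun _ => (Real.exp_pos _).le) ?_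
  · rw [bridgeMix_zero]
    refine h.trans (le_of_eq ?_)
    congr 1
    refine lintegral_congr fun l => ?_
    rw [← Real.exp_add]
    congr 2
    ring
  · intro x y
    -- Comparing inverses, not `x` and `y`, covers negative arguments and the convention `0⁻¹ = 0`,
    -- so the ordering holds at all points.
    rcases le_total ((2 * x ^ 2)⁻¹) ((2 * y ^ 2)⁻¹) with h | h
    · refine mul_nonneg ?_ ?_ <;> rw [sub_nonneg] <;> apply Real.exp_le_exp.2 <;>
        rw [neg_le_neg_iff, div_eq_mul_inv, div_eq_mul_inv] <;> gcongr
    · refine mul_nonneg_of_nonpos_of_nonpos ?_ ?_ <;> rw [sub_nonpos] <;>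
        apply Real.exp_le_exp.2 <;>
        rw [neg_le_neg_iff, div_eq_mul_inv, div_eq_mul_inv] <;> gcongr

/-- The density is `l⁻³ π_st(l⁻² / 2)`. On `(0, 1]` the tail of `π_st` bounds it by a multiple of `l
^ (α - 1)`, and on `(1, ∞)` boundedness of `π_st` gives `l ^ (-3)`. -/
theorem bridgeMixing_univ_lt_top {α : ℝ} (hα0 : 0 < α) (hα1 : α < 1) :
    bridgeMixing α Set.univ < ∞ := by
  obtain ⟨A, B, hA, hB, hAB⟩ := exists_oneSidedStableDensity_asymptotics hα0 hα1
  obtain ⟨C, hC, hCb⟩ := exists_abs_oneSidedStableDensity_le α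
  rw [bridgeMixing, withDensity_apply _ MeasurableSet.univ, Measure.restrict_univ]
  rw [← Set.Ioc_union_Ioi_eq_Ioi zero_le_one, lintegral_union measurableSet_Ioi
    (Set.Ioc_disjoint_Ioi le_rfl)]
  refine ENNReal.add_lt_top.2 ⟨?_, ?_⟩
  · set K := A * 2 ^ (1 + α / 2) + B * 2 ^ (1 + α) with hK
    have hK0 : 0 ≤ K := by positivity
    have hint : IntegrableOn (fun l : ℝ => K * l ^ (α - 1)) (Set.Ioc 0 1) := by
      have := (intervalIntegral.intervalIntegrable_rpow' (a := 0) (b := 1) (r := α - 1)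
        (by linarith)).1
      exact this.const_mul K
    refine lt_of_le_of_lt (setLIntegral_mono_ae (by fun_prop) (ae_of_all _ fun l hl => ?_))
      hint.lintegral_lt_top
    have hl0 : 0 < l := hl.1
    rw [bridgeLocalDensity, ← ENNReal.ofReal_mul (by positivity)]
    apply ENNReal.ofReal_le_ofReal
    have hu : 0 < l ^ (-2 : ℤ) / 2 := by positivity
    have hinv : (l ^ (-2 : ℤ) / 2)⁻¹ = 2 * l ^ (2 : ℝ) := by
      rw [zpow_neg, inv_div, div_inv_eq_mul]
      congr 1
      rw [← Real.rpow_intCast]; norm_num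
    have h1 := hAB _ hu
    rw [hinv, Real.mul_rpow (by norm_num) (by positivity), Real.mul_rpow (by norm_num)
      (by positivity), ← Real.rpow_mul hl0.le, ← Real.rpow_mul hl0.le] at h1
    have h2 : l ^ (2 * (1 + α)) ≤ l ^ (2 * (1 + α / 2)) :=
      Real.rpow_le_rpow_of_exponent_ge hl0 hl.2 (by linarith)
    have h3 : oneSidedStableDensity α (l ^ (-2 : ℤ) / 2) ≤ K * l ^ (2 * (1 + α / 2)) := by
      have h4 : B * (2 ^ (1 + α) * l ^ (2 * (1 + α))) ≤
          B * (2 ^ (1 + α) * l ^ (2 * (1 + α / 2))) := by gcongr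
      rw [hK]
      linarith [le_abs_self (oneSidedStableDensity α (l ^ (-2 : ℤ) / 2) -
        A * (2 ^ (1 + α / 2) * l ^ (2 * (1 + α / 2))))]
    calc l⁻¹ * (l ^ (-2 : ℤ) * oneSidedStableDensity α (l ^ (-2 : ℤ) / 2))
        ≤ l⁻¹ * (l ^ (-2 : ℤ) * (K * l ^ (2 * (1 + α / 2)))) := by gcongr
      _ = K * (l ^ (-1 : ℝ) * l ^ (-2 : ℝ) * l ^ (2 * (1 + α / 2))) := by
        rw [← Real.rpow_intCast, Real.rpow_neg_one]
        push_cast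
        ring
      _ = K * l ^ (α - 1) := by
        rw [← Real.rpow_add hl0, ← Real.rpow_add hl0]
        congr 2
        ring
  · have hint : IntegrableOn (fun l : ℝ => C * l ^ (-3 : ℝ)) (Set.Ioi 1) :=
      (integrableOn_Ioi_rpow_of_lt (by norm_num) one_pos).const_mul C
    refine lt_of_le_of_lt (setLIntegral_mono_ae (by fun_prop) (ae_of_all _ fun l hl => ?_))
      hint.lintegral_lt_top
    have hl0 : 0 < l := one_pos.trans hl
    rw [bridgeLocalDensity, ← ENNReal.ofReal_mul (by positivity)]
    apply ENNReal.ofReal_le_ofReal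
    calc l⁻¹ * (l ^ (-2 : ℤ) * oneSidedStableDensity α (l ^ (-2 : ℤ) / 2))
        ≤ l⁻¹ * (l ^ (-2 : ℤ) * C) := by
          gcongr
          exact (le_abs_self _).trans (hCb _)
      _ = C * (l ^ (-1 : ℝ) * l ^ (-2 : ℝ)) := by
        rw [← Real.rpow_intCast, Real.rpow_neg_one]
        push_cast
        ring
      _ = C * l ^ (-3 : ℝ) := by
        rw [← Real.rpow_add hl0]
        norm_num

theorem bridgeMix_lt_top {α s : ℝ} (hα0 : 0 < α) (hα1 : α < 1) (hs : 0 ≤ s) :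
    bridgeMix α s < ∞ :=
  (bridgeMix_antitone α hs).trans_lt (by
    rw [bridgeMix_zero]; exact bridgeMixing_univ_lt_top hα0 hα1)

/-- The error is `u^(-α/2)` times the order of the leading term, whose coefficient `A` is positive.
-/
theorem exists_oneSidedStableDensity_pos {α : ℝ} (hα0 : 0 < α) (hα1 : α < 1) :
    ∃ U : ℝ, ∀ u, U < u → 0 < oneSidedStableDensity α u := by
  obtain ⟨A, B, hA, hB, hAB⟩ := exists_oneSidedStableDensity_asymptotics hα0 hα1
  have ht : Filter.Tendsto (fun u : ℝ => B * u⁻¹ ^ (α / 2)) Filter.atTop (nhds (B * 0)) := by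
    have h := (tendsto_rpow_neg_atTop (y := α / 2) (by positivity)).const_mul B
    refine h.congr' ?_
    filter_upwards [Filter.eventually_gt_atTop 0] with u hu
    rw [Real.inv_rpow hu.le, Real.rpow_neg hu.le]
  rw [mul_zero] at ht
  have h := (ht.eventually (gt_mem_nhds hA)).and (Filter.eventually_gt_atTop 0)
  obtain ⟨U, hU⟩ := Filter.eventually_atTop.1 h
  refine ⟨U, fun u hu => ?_⟩
  obtain ⟨h1, h0⟩ := hU u hu.le
  have hi : 0 < u⁻¹ := inv_pos.2 h0
  have h2 := abs_le.1 (hAB u h0)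
  have h3 : u⁻¹ ^ (1 + α) = u⁻¹ ^ (1 + α / 2) * u⁻¹ ^ (α / 2) := by
    rw [← Real.rpow_add hi]; congr 1; ring
  rw [h3] at h2
  have h4 : 0 < u⁻¹ ^ (1 + α / 2) := by positivity
  nlinarith [h2.1]

/-- Small `l` means large `l⁻² / 2`, where the stable density is positive. Thus the mixing density
is positive on an interval `(0, e)`, whatever truncation by `ENNReal.ofReal` does elsewhere. -/
theorem bridgeMix_pos {α : ℝ} (hα0 : 0 < α) (hα1 : α < 1) (s : ℝ) : 0 < bridgeMix α s := by
  obtain ⟨U, hU⟩ := exists_oneSidedStableDensity_pos hα0 hα1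
  rw [bridgeMix, bridgeMixing, lintegral_withDensity_eq_lintegral_mul _ (by fun_prop)
    (by fun_prop), lintegral_pos_iff_support (by fun_prop)]
  set V := max U 1 with hV
  have hV0 : 0 < V := lt_of_lt_of_le one_pos (le_max_right _ _)
  set e := (Real.sqrt (2 * V))⁻¹ with he
  have he0 : 0 < e := by positivity
  have hsub : Set.Ioo 0 e ⊆ Function.support ((fun l => ENNReal.ofReal l⁻¹ *
      bridgeLocalDensity α l) * fun l => ENNReal.ofReal (Real.exp (-(s / (2 * l ^ 2))))) := by
    intro l hl
    have hl0 : 0 < l := hl.1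
    have h1 : V < l ^ (-2 : ℤ) / 2 := by
      have h2 : Real.sqrt (2 * V) < l⁻¹ := by
        rw [← inv_inv (Real.sqrt (2 * V))]
        exact inv_strictAnti₀ hl0 hl.2
      have h3 : 2 * V < l⁻¹ ^ 2 := (Real.sqrt_lt' (by positivity)).1 h2
      have h4 : l ^ (-2 : ℤ) = l⁻¹ ^ 2 := by
        rw [zpow_neg, inv_pow]; norm_cast
      rw [h4]; linarith
    have h2 := hU _ ((le_max_left U 1).trans_lt h1)
    have h3 : 0 < l ^ (-2 : ℤ) := by positivity
    rw [Function.mem_support, Pi.mul_apply, bridgeLocalDensity]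
    refine mul_ne_zero (mul_ne_zero ?_ ?_) ?_
    · exact (ENNReal.ofReal_pos.2 (by positivity)).ne'
    · exact (ENNReal.ofReal_pos.2 (by positivity)).ne'
    · exact (ENNReal.ofReal_pos.2 (by positivity)).ne'
  refine lt_of_lt_of_le ?_ (measure_mono hsub)
  rw [Measure.restrict_apply measurableSet_Ioo, Set.inter_eq_left.2 Set.Ioo_subset_Ioi_self,
    Real.volume_Ioo]
  simpa using he0

/-! ### Gaussian factors and integrals over product spaces -/

theorem gaussianPDF_scale {τ l : ℝ} (hτ : 0 < τ) (hl : 0 < l) (b : ℝ) :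
    gaussianPDF 0 (Real.toNNReal (τ ^ 2 * l ^ 2)) b =
      ENNReal.ofReal (Real.sqrt (2 * Real.pi) * τ)⁻¹ *
        (ENNReal.ofReal l⁻¹ * ENNReal.ofReal (Real.exp (-((b / τ) ^ 2 / (2 * l ^ 2))))) := by
  rw [gaussianPDF, ← ENNReal.ofReal_mul (by positivity), ← ENNReal.ofReal_mul (by positivity),
    gaussianPDFReal, Real.coe_toNNReal _ (by positivity), sub_zero,
    Real.sqrt_mul (by positivity), ← mul_pow, Real.sqrt_sq (by positivity)]
  congr 1
  rw [mul_inv, mul_inv, mul_inv, ← mul_assoc, ← mul_assoc]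
  congr 2
  field_simp

/-- A Gaussian scale mixture, tilted by a Gaussian kernel. -/
theorem lintegral_gaussianPDF_mul_exp_mul_bridgeLocalDensity (α : ℝ) {τ : ℝ} (hτ : 0 < τ)
    (b c : ℝ) :
    ∫⁻ l in Set.Ioi 0, gaussianPDF 0 (Real.toNNReal (τ ^ 2 * l ^ 2)) b * bridgeLocalDensity α l *
        ENNReal.ofReal (Real.exp (-((c / τ) ^ 2 / (2 * l ^ 2)))) =
      ENNReal.ofReal (Real.sqrt (2 * Real.pi) * τ)⁻¹ *
        bridgeMix α ((b / τ) ^ 2 + (c / τ) ^ 2) := by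
  rw [bridgeMix, bridgeMixing, lintegral_withDensity_eq_lintegral_mul _ (by fun_prop)
    (by fun_prop), ← lintegral_const_mul _ (by fun_prop)]
  refine setLIntegral_congr_fun measurableSet_Ioi fun l hl => ?_
  have hl : 0 < l := hl
  simp only [Pi.mul_apply]
  rw [gaussianPDF_scale hτ hl, add_div, neg_add, Real.exp_add, ENNReal.ofReal_mul (by positivity)]
  ring

theorem lintegral_pi_prod_eq_prod {n : ℕ} (μ : Fin n → Measure ℝ) [∀ i, SigmaFinite (μ i)]
    {f : Fin n → ℝ → ℝ≥0∞} (hf : ∀ i, Measurable (f i)) :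
    ∫⁻ x, ∏ i, f i (x i) ∂(Measure.pi μ) = ∏ i, ∫⁻ x, f i x ∂(μ i) := by
  induction n with
  | zero => simp
  | succ n ih =>
    have hmp := (measurePreserving_piFinSuccAbove μ 0).symm
    rw [← hmp.lintegral_comp_emb (MeasurableEquiv.measurableEmbedding _)]
    simp_rw [MeasurableEquiv.piFinSuccAbove_symm_apply, Fin.insertNthEquiv, Fin.prod_univ_succ,
      Fin.insertNth_zero, Equiv.coe_fn_mk, Fin.cons_succ, Fin.zero_succAbove, cast_eq,
      Fin.cons_zero]
    rw [← ih (fun i : Fin n => μ i.succ) (f := fun i : Fin n => f i.succ) fun i : Fin n => hf i.succ]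
    exact lintegral_prod_mul (hf 0).aemeasurable
      (Finset.measurable_prod _ fun (i : Fin n) _ => (hf i.succ).comp (measurable_pi_apply i)).aemeasurable

/-! ### A collapsed three-block Gibbs sampler -/

section CollapsedGibbs

/-- The transition density of a collapsed Gibbs sampler with target density
`W β * c τ l β * ℓ l`. -/
noncomputable def collapsedDensity {B L T : Type*} [MeasurableSpace B] [MeasurableSpace L]
    [MeasurableSpace T] (μ : Measure B) (ν : Measure L) (π : Measure T) (W : B → ℝ≥0∞)
    (c : T → L → B → ℝ≥0∞) (ℓ : L → ℝ≥0∞) (b : B) (s : B × L × T) : ℝ≥0∞ :=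
  (∫⁻ l, c s.2.2 l b * ℓ l ∂ν) / (∫⁻ τ, ∫⁻ l, c τ l b * ℓ l ∂ν ∂π) *
    (c s.2.2 s.2.1 b * ℓ s.2.1 / ∫⁻ l, c s.2.2 l b * ℓ l ∂ν) *
    (W s.1 * c s.2.2 s.2.1 s.1 / ∫⁻ b', W b' * c s.2.2 s.2.1 b' ∂μ)

variable {B L T : Type*} [MeasurableSpace B] [MeasurableSpace L] [MeasurableSpace T]
  {μ : Measure B} {ν : Measure L} {π : Measure T}
  {W : B → ℝ≥0∞} {c : T → L → B → ℝ≥0∞} {ℓ : L → ℝ≥0∞}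

theorem measurable_collapsedDensity [SFinite μ] [SFinite ν] [SFinite π] (hW : Measurable W)
    (hc : Measurable fun q : T × L × B => c q.1 q.2.1 q.2.2) (hℓ : Measurable ℓ) :
    Measurable fun q : B × B × L × T => collapsedDensity μ ν π W c ℓ q.1 q.2 := by
  have hm : Measurable fun q : T × B => ∫⁻ l, c q.1 l q.2 * ℓ l ∂ν := by
    have : Measurable fun q : (T × B) × L => c q.1.1 q.2 q.1.2 * ℓ q.2 :=
      (hc.comp (by fun_prop : Measurable fun q : (T × B) × L => (q.1.1, q.2, q.1.2))).mul
        (hℓ.comp measurable_snd)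
    exact this.lintegral_prod_right'
  have hM : Measurable fun b : B => ∫⁻ τ, ∫⁻ l, c τ l b * ℓ l ∂ν ∂π := hm.lintegral_prod_left'
  have hD : Measurable fun q : T × L => ∫⁻ b, W b * c q.1 q.2 b ∂μ := by
    have : Measurable fun q : (T × L) × B => W q.2 * c q.1.1 q.1.2 q.2 :=
      (hW.comp measurable_snd).mul
        (hc.comp (by fun_prop : Measurable fun q : (T × L) × B => (q.1.1, q.1.2, q.2)))
    exact this.lintegral_prod_right'
  have hc1 : Measurable fun q : B × B × L × T => c q.2.2.2 q.2.2.1 q.1 :=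
    hc.comp (by fun_prop : Measurable fun q : B × B × L × T => (q.2.2.2, q.2.2.1, q.1))
  have hc2 : Measurable fun q : B × B × L × T => c q.2.2.2 q.2.2.1 q.2.1 :=
    hc.comp (by fun_prop : Measurable fun q : B × B × L × T => (q.2.2.2, q.2.2.1, q.2.1))
  have hm1 : Measurable fun q : B × B × L × T => ∫⁻ l, c q.2.2.2 l q.1 * ℓ l ∂ν :=
    hm.comp (by fun_prop : Measurable fun q : B × B × L × T => (q.2.2.2, q.1))
  have hD1 : Measurable fun q : B × B × L × T => ∫⁻ b, W b * c q.2.2.2 q.2.2.1 b ∂μ :=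
    hD.comp (by fun_prop : Measurable fun q : B × B × L × T => (q.2.2.2, q.2.2.1))
  unfold collapsedDensity
  exact ((hm1.div (hM.comp measurable_fst)).mul ((hc1.mul (hℓ.comp (by fun_prop))).div hm1)).mul
    (((hW.comp (by fun_prop)).mul hc2).div hD1)

/-- The block normalizations of the sampler are positive and finite. -/
structure IsProperCollapsed (μ : Measure B) (ν : Measure L) (π : Measure T) (W : B → ℝ≥0∞)
    (c : T → L → B → ℝ≥0∞) (ℓ : L → ℝ≥0∞) : Prop where
  measurable_weight : Measurable W
  measurable_kernel : Measurable fun q : T × L × B => c q.1 q.2.1 q.2.2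
  measurable_local : Measurable ℓ
  inner : ∀ᵐ τ ∂π, ∀ b, (∫⁻ l, c τ l b * ℓ l ∂ν) ≠ 0 ∧ (∫⁻ l, c τ l b * ℓ l ∂ν) ≠ ∞
  outer : ∀ b, (∫⁻ τ, ∫⁻ l, c τ l b * ℓ l ∂ν ∂π) ≠ 0 ∧ (∫⁻ τ, ∫⁻ l, c τ l b * ℓ l ∂ν ∂π) ≠ ∞
  coef : ∀ᵐ z ∂(ν.prod π), (∫⁻ b, W b * c z.2 z.1 b ∂μ) ≠ 0 ∧ (∫⁻ b, W b * c z.2 z.1 b ∂μ) ≠ ∞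

namespace IsProperCollapsed

theorem measurable_section (h : IsProperCollapsed μ ν π W c ℓ) (τ : T) (l : L) :
    Measurable fun b => c τ l b :=
  h.measurable_kernel.comp (measurable_const.prodMk (measurable_const.prodMk measurable_id))

theorem measurable_local_section (h : IsProperCollapsed μ ν π W c ℓ) (τ : T) (b : B) :
    Measurable fun l => c τ l b * ℓ l :=
  (h.measurable_kernel.comp
    (measurable_const.prodMk (measurable_id.prodMk measurable_const))).mul h.measurable_local

theorem measurable_joint (h : IsProperCollapsed μ ν π W c ℓ) :
    Measurable fun s : B × L × T => W s.1 * c s.2.2 s.2.1 s.1 * ℓ s.2.1 :=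
  ((h.measurable_weight.comp measurable_fst).mul (h.measurable_kernel.comp
    (by fun_prop : Measurable fun s : B × L × T => (s.2.2, s.2.1, s.1)))).mul
    (h.measurable_local.comp (by fun_prop))

variable [SFinite ν]

theorem measurable_inner (h : IsProperCollapsed μ ν π W c ℓ) (b : B) :
    Measurable fun τ => ∫⁻ l, c τ l b * ℓ l ∂ν := by
  have : Measurable fun q : T × L => c q.1 q.2 b * ℓ q.2 :=
    (h.measurable_kernel.comp (by fun_prop : Measurable fun q : T × L => (q.1, q.2, b))).mul
      (h.measurable_local.comp measurable_snd)
  exact this.lintegral_prod_right'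

/-- A lower bound for the transition density of the marginal chain. -/
theorem le_lintegral_density (h : IsProperCollapsed μ ν π W c ℓ) (b b' : B) (r : ℝ≥0∞)
    {e : T → L → ℝ≥0∞}
    (he : ∀ᵐ τ ∂π, ∀ᵐ l ∂ν,
      W b' * e τ l ≤ W b' * c τ l b' / ∫⁻ b'', W b'' * c τ l b'' ∂μ)
    (hr : ∀ᵐ τ ∂π, r * ∫⁻ l, c τ l b * ℓ l ∂ν ≤ ∫⁻ l, c τ l b * ℓ l * e τ l ∂ν) :
    W b' * r ≤ ∫⁻ τ, ∫⁻ l, collapsedDensity μ ν π W c ℓ b (b', l, τ) ∂ν ∂π := by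
  -- The law of `τ | b` has total mass one, so the bound `W b' * r`, constant in `τ`, equals its own
  -- average.
  have h1 : ∫⁻ τ, (∫⁻ l, c τ l b * ℓ l ∂ν) * ((∫⁻ τ, ∫⁻ l, c τ l b * ℓ l ∂ν ∂π)⁻¹ * (W b' * r)) ∂π
      = W b' * r := by
    rw [lintegral_mul_const _ (h.measurable_inner b), ← mul_assoc, ENNReal.mul_inv_cancel
      (h.outer b).1 (h.outer b).2, one_mul]
  rw [← h1]
  refine lintegral_mono_ae ?_
  filter_upwards [he, hr, h.inner] with τ he hr hm
  simp only [collapsedDensity]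
  have hm := hm b
  generalize hM : (∫⁻ τ, ∫⁻ l, c τ l b * ℓ l ∂ν ∂π) = M
  generalize hmb : (∫⁻ l, c τ l b * ℓ l ∂ν) = m at *
  calc m * (M⁻¹ * (W b' * r)) = (M⁻¹ * W b') * (r * m) := by ring
    _ ≤ (M⁻¹ * W b') * ∫⁻ l, c τ l b * ℓ l * e τ l ∂ν := by gcongr
    -- Only this direction is needed, so `e` need not be measurable.
    _ ≤ ∫⁻ l, (M⁻¹ * W b') * (c τ l b * ℓ l * e τ l) ∂ν := lintegral_const_mul_le _ _
    _ ≤ _ := by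
      refine lintegral_mono_ae ?_
      filter_upwards [he] with l he
      rw [div_eq_mul_inv m, div_eq_mul_inv (c τ l b * ℓ l)]
      calc (M⁻¹ * W b') * (c τ l b * ℓ l * e τ l)
          = (M⁻¹ * (m * m⁻¹)) * (c τ l b * ℓ l) * (W b' * e τ l) := by
            rw [ENNReal.mul_inv_cancel hm.1 hm.2]; ring
        _ ≤ (M⁻¹ * (m * m⁻¹)) * (c τ l b * ℓ l) *
            (W b' * c τ l b' / ∫⁻ b'', W b'' * c τ l b'' ∂μ) := by gcongr
        _ = _ := by ring

variable [SFinite π]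

theorem measurable_outer (h : IsProperCollapsed μ ν π W c ℓ) :
    Measurable fun b : B => ∫⁻ τ, ∫⁻ l, c τ l b * ℓ l ∂ν ∂π := by
  have e : Measurable fun q : (B × T) × L => c q.1.2 q.2 q.1.1 * ℓ q.2 :=
    (h.measurable_kernel.comp
      (by fun_prop : Measurable fun q : (B × T) × L => (q.1.2, q.2, q.1.1))).mul
      (h.measurable_local.comp measurable_snd)
  exact e.lintegral_prod_right'.lintegral_prod_right'

/-- The total mass of the joint density. -/
theorem lintegral_joint (h : IsProperCollapsed μ ν π W c ℓ) :
    ∫⁻ s, W s.1 * c s.2.2 s.2.1 s.1 * ℓ s.2.1 ∂(μ.prod (ν.prod π)) =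
      ∫⁻ b, W b * ∫⁻ τ, ∫⁻ l, c τ l b * ℓ l ∂ν ∂π ∂μ := by
  rw [lintegral_prod _ h.measurable_joint.aemeasurable]
  refine lintegral_congr fun b => ?_
  have e : Measurable fun z : L × T => c z.2 z.1 b * ℓ z.1 :=
    (h.measurable_kernel.comp (by fun_prop : Measurable fun z : L × T => (z.2, z.1, b))).mul
      (h.measurable_local.comp measurable_fst)
  simp_rw [mul_assoc (W b)]
  rw [lintegral_const_mul _ e, lintegral_prod_symm' _ e]

variable [SFinite μ]

theorem measurable_density (h : IsProperCollapsed μ ν π W c ℓ) :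
    Measurable fun q : B × B × L × T => collapsedDensity μ ν π W c ℓ q.1 q.2 :=
  measurable_collapsedDensity h.measurable_weight h.measurable_kernel h.measurable_local

/-- The blocks integrate to one in the reverse of the order in which they are drawn: the
coefficients, then the local scales, then the global scale. -/
theorem lintegral_density (h : IsProperCollapsed μ ν π W c ℓ) (b : B) :
    ∫⁻ s, collapsedDensity μ ν π W c ℓ b s ∂(μ.prod (ν.prod π)) = 1 := by
  have hm : Measurable fun s => collapsedDensity μ ν π W c ℓ b s :=
    h.measurable_density.comp measurable_prodMk_left
  rw [lintegral_prod_symm' _ hm]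
  have h1 : ∫⁻ z : L × T, ∫⁻ b', collapsedDensity μ ν π W c ℓ b (b', z) ∂μ ∂(ν.prod π) =
      ∫⁻ z : L × T, (∫⁻ l, c z.2 l b * ℓ l ∂ν) / (∫⁻ τ, ∫⁻ l, c τ l b * ℓ l ∂ν ∂π) *
        (c z.2 z.1 b * ℓ z.1 / ∫⁻ l, c z.2 l b * ℓ l ∂ν) ∂(ν.prod π) := by
    refine lintegral_congr_ae ?_
    filter_upwards [h.coef] with z hz
    have hs : Measurable fun b' => W b' * c z.2 z.1 b' :=
      h.measurable_weight.mul (h.measurable_section _ _)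
    simp only [collapsedDensity]
    rw [lintegral_const_mul _ (hs.div_const _)]
    simp_rw [div_eq_mul_inv]
    rw [lintegral_mul_const _ hs, ENNReal.mul_inv_cancel hz.1 hz.2, mul_one]
  have hm2 : Measurable fun z : L × T =>
      (∫⁻ l, c z.2 l b * ℓ l ∂ν) / (∫⁻ τ, ∫⁻ l, c τ l b * ℓ l ∂ν ∂π) *
        (c z.2 z.1 b * ℓ z.1 / ∫⁻ l, c z.2 l b * ℓ l ∂ν) := by
    have e1 : Measurable fun z : L × T => ∫⁻ l, c z.2 l b * ℓ l ∂ν :=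
      (h.measurable_inner b).comp measurable_snd
    have e2 : Measurable fun z : L × T => c z.2 z.1 b :=
      h.measurable_kernel.comp (by fun_prop : Measurable fun z : L × T => (z.2, z.1, b))
    exact (e1.div_const _).mul ((e2.mul (h.measurable_local.comp measurable_fst)).div e1)
  rw [h1, lintegral_prod_symm' _ hm2]
  have h2 : ∫⁻ τ, ∫⁻ l, (∫⁻ l, c τ l b * ℓ l ∂ν) / (∫⁻ τ, ∫⁻ l, c τ l b * ℓ l ∂ν ∂π) *
        (c τ l b * ℓ l / ∫⁻ l, c τ l b * ℓ l ∂ν) ∂ν ∂π =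
      ∫⁻ τ, (∫⁻ l, c τ l b * ℓ l ∂ν) / (∫⁻ τ, ∫⁻ l, c τ l b * ℓ l ∂ν ∂π) ∂π := by
    refine lintegral_congr_ae ?_
    filter_upwards [h.inner] with τ hτ
    have hs := h.measurable_local_section τ b
    rw [lintegral_const_mul _ (hs.div_const _)]
    simp_rw [div_eq_mul_inv]
    rw [lintegral_mul_const _ hs, ENNReal.mul_inv_cancel (hτ b).1 (hτ b).2, mul_one]
  rw [h2]
  simp_rw [div_eq_mul_inv]
  rw [lintegral_mul_const _ (h.measurable_inner b), ENNReal.mul_inv_cancel (h.outer b).1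
    (h.outer b).2]

/-- The joint density is invariant. -/
theorem lintegral_joint_mul_density (h : IsProperCollapsed μ ν π W c ℓ)
    {g : B × L × T → ℝ≥0∞} (hg : Measurable g) :
    ∫⁻ s, W s.1 * c s.2.2 s.2.1 s.1 * ℓ s.2.1 *
        (∫⁻ s', collapsedDensity μ ν π W c ℓ s.1 s' * g s' ∂(μ.prod (ν.prod π)))
        ∂(μ.prod (ν.prod π)) =
      ∫⁻ s, W s.1 * c s.2.2 s.2.1 s.1 * ℓ s.2.1 * g s ∂(μ.prod (ν.prod π)) := by
  have hK : Measurable fun b =>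
      ∫⁻ s', collapsedDensity μ ν π W c ℓ b s' * g s' ∂(μ.prod (ν.prod π)) :=
    (h.measurable_density.mul (hg.comp measurable_snd)).lintegral_prod_right'
  have hJK : Measurable fun s : B × L × T => W s.1 * c s.2.2 s.2.1 s.1 * ℓ s.2.1 *
      ∫⁻ s', collapsedDensity μ ν π W c ℓ s.1 s' * g s' ∂(μ.prod (ν.prod π)) :=
    h.measurable_joint.mul (hK.comp measurable_fst)
  rw [lintegral_prod _ hJK.aemeasurable]
  -- The transition depends on the current state through `b` alone, so the other two blocks
  -- integrate out of the joint density, leaving the outer normalizer.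
  have h1 : ∀ b, ∫⁻ z : L × T, W b * c z.2 z.1 b * ℓ z.1 *
        (∫⁻ s', collapsedDensity μ ν π W c ℓ b s' * g s' ∂(μ.prod (ν.prod π))) ∂(ν.prod π) =
      ∫⁻ s', W b * (∫⁻ τ, ∫⁻ l, c τ l b * ℓ l ∂ν ∂π) *
        (collapsedDensity μ ν π W c ℓ b s' * g s') ∂(μ.prod (ν.prod π)) := by
    intro b
    have e : Measurable fun z : L × T => c z.2 z.1 b * ℓ z.1 :=
      (h.measurable_kernel.comp (by fun_prop : Measurable fun z : L × T => (z.2, z.1, b))).mul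
        (h.measurable_local.comp measurable_fst)
    have e2 : Measurable fun s' => collapsedDensity μ ν π W c ℓ b s' * g s' :=
      (h.measurable_density.comp measurable_prodMk_left).mul hg
    simp_rw [mul_assoc (W b)]
    rw [lintegral_const_mul _ (e.mul_const _), lintegral_mul_const _ e,
      lintegral_prod_symm' _ e, lintegral_const_mul _ (e2.const_mul _), lintegral_const_mul _ e2]
  simp_rw [h1]
  have hJoint : Measurable fun q : B × B × L × T =>
      W q.1 * (∫⁻ τ, ∫⁻ l, c τ l q.1 * ℓ l ∂ν ∂π) *
        (collapsedDensity μ ν π W c ℓ q.1 q.2 * g q.2) :=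
    ((h.measurable_weight.comp measurable_fst).mul (h.measurable_outer.comp measurable_fst)).mul
      (h.measurable_density.mul (hg.comp measurable_snd))
  rw [lintegral_lintegral_swap hJoint.aemeasurable]
  refine lintegral_congr_ae ?_
  have a1 := (Measure.quasiMeasurePreserving_snd (μ := μ) (ν := ν.prod π)).ae h.coef
  have a2 := (Measure.quasiMeasurePreserving_snd (μ := μ) (ν := ν.prod π)).ae
    ((Measure.quasiMeasurePreserving_snd (μ := ν) (ν := π)).ae h.inner)
  filter_upwards [a1, a2] with s' hD hm
  -- The outer normalizer cancels that of the `τ` draw, and the inner one cancels between the `τ`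
  -- and `l` draws. What remains depends on `b` only through `W b * c τ l b`, whose integral is the
  -- last denominator. The cancellation is needed for all `b` at a fixed `τ`, hence the order of
  -- quantifiers in `inner`.
  have e3 : ∀ b, W b * (∫⁻ τ, ∫⁻ l, c τ l b * ℓ l ∂ν ∂π) *
        (collapsedDensity μ ν π W c ℓ b s' * g s') =
      W b * c s'.2.2 s'.2.1 b * (ℓ s'.2.1 * (W s'.1 * c s'.2.2 s'.2.1 s'.1 /
        ∫⁻ b', W b' * c s'.2.2 s'.2.1 b' ∂μ) * g s') := by
    intro b
    rw [collapsedDensity]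
    generalize hMb : (∫⁻ τ, ∫⁻ l, c τ l b * ℓ l ∂ν ∂π) = M
    generalize hmb : (∫⁻ l, c s'.2.2 l b * ℓ l ∂ν) = m
    have hM0 : M ≠ 0 ∧ M ≠ ∞ := hMb ▸ h.outer b
    have hm0 : m ≠ 0 ∧ m ≠ ∞ := hmb ▸ hm b
    generalize (W s'.1 * c s'.2.2 s'.2.1 s'.1 / ∫⁻ b', W b' * c s'.2.2 s'.2.1 b' ∂μ) = R
    rw [div_eq_mul_inv, div_eq_mul_inv]
    calc _ = (M * M⁻¹) * (m * m⁻¹) * (W b * c s'.2.2 s'.2.1 b * (ℓ s'.2.1 * R * g s')) := by ring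
      _ = _ := by
        rw [ENNReal.mul_inv_cancel hM0.1 hM0.2, ENNReal.mul_inv_cancel hm0.1 hm0.2, one_mul,
          one_mul]
  simp_rw [e3]
  have hs : Measurable fun b => W b * c s'.2.2 s'.2.1 b :=
    h.measurable_weight.mul (h.measurable_section _ _)
  rw [lintegral_mul_const _ hs, div_eq_mul_inv]
  generalize (∫⁻ b', W b' * c s'.2.2 s'.2.1 b' ∂μ) = D at *
  calc _ = (D * D⁻¹) * (W s'.1 * c s'.2.2 s'.2.1 s'.1 * ℓ s'.2.1 * g s') := by ring
    _ = _ := by rw [ENNReal.mul_inv_cancel hD.1 hD.2, one_mul]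

/-- The marginal law of the first block after one cycle. -/
theorem lintegral_preimage_fst (h : IsProperCollapsed μ ν π W c ℓ) (b : B) (A : Set B) :
    ∫⁻ s in Prod.fst ⁻¹' A, collapsedDensity μ ν π W c ℓ b s ∂(μ.prod (ν.prod π)) =
      ∫⁻ b' in A, ∫⁻ τ, ∫⁻ l, collapsedDensity μ ν π W c ℓ b (b', l, τ) ∂ν ∂π ∂μ := by
  have hm : Measurable fun s => collapsedDensity μ ν π W c ℓ b s :=
    h.measurable_density.comp measurable_prodMk_left
  rw [← Set.prod_univ, setLIntegral_prod _ hm.aemeasurable, Measure.restrict_univ]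
  refine lintegral_congr fun b' => ?_
  exact lintegral_prod_symm' _ (hm.comp measurable_prodMk_left)

end IsProperCollapsed

end CollapsedGibbs

/-! ### The bridge probit model -/

/-- A half-line null for the Gaussian would be null for Lebesgue measure. -/
theorem stdNormalCDF_pos (t : ℝ) : 0 < stdNormalCDF t := by
  rw [stdNormalCDF, cdf_eq_real]
  refine ENNReal.toReal_pos (fun h => ?_) (measure_ne_top _ _)
  have := gaussianReal_absolutelyContinuous' 0 one_ne_zero h
  simp at this

theorem stdNormalCDF_lt_one (t : ℝ) : stdNormalCDF t < 1 := by
  have h1 : (gaussianReal 0 1).real (Set.Iic t)ᶜ = 1 - (gaussianReal 0 1).real (Set.Iic t) :=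
    probReal_compl_eq_one_sub measurableSet_Iic
  have h2 : 0 < (gaussianReal 0 1).real (Set.Iic t)ᶜ := by
    refine ENNReal.toReal_pos (fun h => ?_) (measure_ne_top _ _)
    have := gaussianReal_absolutelyContinuous' 0 one_ne_zero h
    simp at this
  rw [stdNormalCDF, cdf_eq_real]
  linarith

theorem measurable_stdNormalCDF : Measurable stdNormalCDF :=
  (monotone_cdf (gaussianReal 0 1)).measurable

section Model

variable {n p : ℕ} (X : Matrix (Fin n) (Fin p) ℝ) (y : Fin n → Bool)

theorem measurable_probitLikelihood : Measurable (probitLikelihood X y) := by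
  unfold probitLikelihood
  refine Finset.measurable_prod _ fun i _ => ?_
  have h1 : Measurable fun β : Fin p → ℝ => X.mulVec β i := by
    simp only [Matrix.mulVec, dotProduct]
    fun_prop
  have h2 := measurable_stdNormalCDF.comp h1
  cases y i
  · exact (h2.const_sub 1).ennreal_ofReal
  · exact h2.ennreal_ofReal

theorem probitLikelihood_ne_zero (β : Fin p → ℝ) : probitLikelihood X y β ≠ 0 := by
  refine Finset.prod_ne_zero_iff.2 fun i _ => (ENNReal.ofReal_pos.2 ?_).ne'
  split_ifs
  · exact stdNormalCDF_pos _
  · linarith [stdNormalCDF_lt_one (X.mulVec β i)]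

theorem probitLikelihood_le_one (β : Fin p → ℝ) : probitLikelihood X y β ≤ 1 := by
  refine Finset.prod_le_one' fun i _ => ENNReal.ofReal_le_one.2 ?_
  split_ifs
  · exact (stdNormalCDF_lt_one _).le
  · linarith [stdNormalCDF_pos (X.mulVec β i)]

/-- Lets the fictitious likelihood, a function of the mean, be read as a Gaussian density in `β`. -/
theorem gaussianPDF_comm (v : ℝ≥0) (a b : ℝ) : gaussianPDF a v b = gaussianPDF b v a := by
  rw [gaussianPDF, gaussianPDF, gaussianPDFReal, gaussianPDFReal, ← neg_sub, neg_sq]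

theorem measurable_fictitiousLikelihood (ζ : ℝ) :
    Measurable (fictitiousLikelihood (p := p) ζ) := by
  unfold fictitiousLikelihood
  simp_rw [gaussianPDF_comm _ _ 0]
  refine Finset.measurable_prod _ fun i _ => ?_
  exact (measurable_gaussianPDF _ _).comp (measurable_pi_apply i)

theorem toNNReal_ne_zero_of_pos {x : ℝ} (hx : 0 < x) : Real.toNNReal x ≠ 0 :=
  (Real.toNNReal_pos.2 hx).ne'

theorem fictitiousLikelihood_ne_zero {ζ : ℝ} (hζ : 0 < ζ) (β : Fin p → ℝ) :
    fictitiousLikelihood ζ β ≠ 0 :=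
  Finset.prod_ne_zero_iff.2 fun _ _ =>
    (gaussianPDF_pos _ (toNNReal_ne_zero_of_pos (by positivity)) _).ne'

theorem lintegral_fictitiousLikelihood {ζ : ℝ} (hζ : 0 < ζ) :
    ∫⁻ β : Fin p → ℝ, fictitiousLikelihood ζ β = 1 := by
  unfold fictitiousLikelihood
  simp_rw [gaussianPDF_comm _ _ 0]
  rw [volume_pi, lintegral_pi_prod_eq_prod _ fun _ => measurable_gaussianPDF _ _]
  refine Finset.prod_eq_one fun i _ => ?_
  exact lintegral_gaussianPDF_eq_one _ (toNNReal_ne_zero_of_pos (by positivity))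

theorem lintegral_weight_le_one {ζ : ℝ} (hζ : 0 < ζ) :
    ∫⁻ β : Fin p → ℝ, probitLikelihood X y β * fictitiousLikelihood ζ β ≤ 1 := by
  rw [← lintegral_fictitiousLikelihood (p := p) hζ]
  exact lintegral_mono fun β => mul_le_of_le_one_left' (probitLikelihood_le_one X y β)

theorem measurable_coefPrior :
    Measurable fun q : ℝ × (Fin p → ℝ) × (Fin p → ℝ) => coefPrior q.1 q.2.1 q.2.2 := by
  unfold coefPrior
  refine Finset.measurable_prod _ fun i _ => ?_
  exact (measurable_uncurry_gaussianPDFReal.comp (by fun_prop :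
    Measurable fun q : ℝ × (Fin p → ℝ) × (Fin p → ℝ) =>
      ((0 : ℝ), Real.toNNReal (q.1 ^ 2 * q.2.1 i ^ 2), q.2.2 i))).ennreal_ofReal

theorem measurable_localPrior (α : ℝ) : Measurable (localPrior (p := p) α) := by
  unfold localPrior
  exact Finset.measurable_prod _ fun i _ =>
    (measurable_bridgeLocalDensity α).comp (measurable_pi_apply i)

/-! ### The conditional law of the coefficients -/

/-- The Gaussian kernel of `coefPrior` without its normalizing factor. -/
noncomputable def coefKernel (τ : ℝ) (l β : Fin p → ℝ) : ℝ≥0∞ :=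
  ∏ j, ENNReal.ofReal (Real.exp (-((β j / τ) ^ 2 / (2 * l j ^ 2))))

/-- The normalizing factor of `coefPrior`. -/
noncomputable def coefNorm (τ : ℝ) (l : Fin p → ℝ) : ℝ≥0∞ :=
  ∏ j, ENNReal.ofReal (Real.sqrt (2 * Real.pi) * τ)⁻¹ * ENNReal.ofReal (l j)⁻¹

theorem coefPrior_eq {τ : ℝ} (hτ : 0 < τ) {l : Fin p → ℝ} (hl : ∀ j, 0 < l j) (β : Fin p → ℝ) :
    coefPrior τ l β = coefNorm τ l * coefKernel τ l β := by
  rw [coefPrior, coefNorm, coefKernel, ← Finset.prod_mul_distrib]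
  refine Finset.prod_congr rfl fun j _ => ?_
  rw [gaussianPDF_scale hτ (hl j), mul_assoc]

theorem coefNorm_ne_zero {τ : ℝ} (hτ : 0 < τ) {l : Fin p → ℝ} (hl : ∀ j, 0 < l j) :
    coefNorm τ l ≠ 0 := by
  refine Finset.prod_ne_zero_iff.2 fun j _ => mul_ne_zero ?_ ?_
  · exact (ENNReal.ofReal_pos.2 (by positivity)).ne'
  · exact (ENNReal.ofReal_pos.2 (inv_pos.2 (hl j))).ne'

theorem coefNorm_ne_top (τ : ℝ) (l : Fin p → ℝ) : coefNorm τ l ≠ ∞ :=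
  ENNReal.prod_ne_top fun _ _ => ENNReal.mul_ne_top ENNReal.ofReal_ne_top ENNReal.ofReal_ne_top

theorem coefKernel_le_one (τ : ℝ) (l β : Fin p → ℝ) : coefKernel τ l β ≤ 1 := by
  refine Finset.prod_le_one' fun j _ => ENNReal.ofReal_le_one.2 (Real.exp_le_one_iff.2 ?_)
  exact neg_nonpos.2 (by positivity)

theorem coefKernel_ne_zero (τ : ℝ) (l β : Fin p → ℝ) : coefKernel τ l β ≠ 0 :=
  Finset.prod_ne_zero_iff.2 fun _ _ => (ENNReal.ofReal_pos.2 (Real.exp_pos _)).ne'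

/-- The Gaussian kernel is at most one and the weight has mass at most one. The factor `coefNorm`,
unbounded as `l → 0`, later cancels against the numerator. -/
theorem lintegral_weight_mul_coefPrior_le {ζ τ : ℝ} (hζ : 0 < ζ) (hτ : 0 < τ) {l : Fin p → ℝ}
    (hl : ∀ j, 0 < l j) :
    ∫⁻ β, probitLikelihood X y β * fictitiousLikelihood ζ β * coefPrior τ l β ≤ coefNorm τ l := by
  calc ∫⁻ β, probitLikelihood X y β * fictitiousLikelihood ζ β * coefPrior τ l β
      ≤ ∫⁻ β, probitLikelihood X y β * fictitiousLikelihood ζ β * coefNorm τ l := by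
        refine lintegral_mono fun β => ?_
        rw [coefPrior_eq hτ hl]
        gcongr
        exact mul_le_of_le_one_right' (coefKernel_le_one τ l β)
    _ = (∫⁻ β, probitLikelihood X y β * fictitiousLikelihood ζ β) * coefNorm τ l :=
        lintegral_mul_const _
          ((measurable_probitLikelihood X y).mul (measurable_fictitiousLikelihood ζ))
    _ ≤ coefNorm τ l := mul_le_of_le_one_left' (lintegral_weight_le_one X y hζ)

theorem lintegral_weight_mul_coefPrior_ne_zero {ζ τ : ℝ} (hζ : 0 < ζ) (hτ : 0 < τ)
    {l : Fin p → ℝ} (hl : ∀ j, 0 < l j) :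
    ∫⁻ β, probitLikelihood X y β * fictitiousLikelihood ζ β * coefPrior τ l β ≠ 0 := by
  have h1 : Measurable fun β : Fin p → ℝ => (τ, l, β) := by fun_prop
  have hc := (measurable_coefPrior (p := p)).comp h1
  have hw : Measurable fun β : Fin p → ℝ => probitLikelihood X y β * fictitiousLikelihood ζ β :=
    (measurable_probitLikelihood X y).mul (measurable_fictitiousLikelihood ζ)
  have hm : Measurable fun β : Fin p → ℝ =>
      probitLikelihood X y β * fictitiousLikelihood ζ β * coefPrior τ l β := hw.mul hc
  have hs : Function.support (fun β : Fin p → ℝ =>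
      probitLikelihood X y β * fictitiousLikelihood ζ β * coefPrior τ l β) = Set.univ := by
    refine Set.eq_univ_of_forall fun β => ?_
    rw [Function.mem_support, coefPrior_eq hτ hl]
    exact mul_ne_zero (mul_ne_zero (probitLikelihood_ne_zero X y β)
      (fictitiousLikelihood_ne_zero hζ β))
      (mul_ne_zero (coefNorm_ne_zero hτ hl) (coefKernel_ne_zero τ l β))
  refine ((lintegral_pos_iff_support hm).2 ?_).ne'
  rw [hs]
  exact Measure.measure_univ_pos.2 (NeZero.ne _)

/-- Lower bound for the conditional density of the coefficients. -/
theorem weight_mul_coefKernel_le {ζ τ : ℝ} (hζ : 0 < ζ) (hτ : 0 < τ) {l : Fin p → ℝ}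
    (hl : ∀ j, 0 < l j) (β : Fin p → ℝ) :
    probitLikelihood X y β * fictitiousLikelihood ζ β * coefKernel τ l β ≤
      probitLikelihood X y β * fictitiousLikelihood ζ β * coefPrior τ l β /
        ∫⁻ β', probitLikelihood X y β' * fictitiousLikelihood ζ β' * coefPrior τ l β' := by
  have h := lintegral_weight_mul_coefPrior_le X y hζ hτ hl
  refine (ENNReal.le_div_iff_mul_le
    (Or.inl (lintegral_weight_mul_coefPrior_ne_zero X y hζ hτ hl))
    (Or.inl (h.trans_lt (coefNorm_ne_top τ l).lt_top).ne)).2 ?_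
  rw [coefPrior_eq hτ hl β]
  calc _ ≤ probitLikelihood X y β * fictitiousLikelihood ζ β * coefKernel τ l β * coefNorm τ l :=
        mul_le_mul_right h _
    _ = _ := by ring

instance sigmaFinite_localRef (p : ℕ) : SigmaFinite (localRef p) := by
  unfold localRef; infer_instance

instance sFinite_stateRef (p : ℕ) (πglo : Measure ℝ) [SFinite πglo] :
    SFinite (stateRef p πglo) := by
  unfold stateRef; infer_instance

theorem ae_localRef_pos (p : ℕ) : ∀ᵐ l ∂(localRef p), ∀ j, 0 < l j := by
  rw [ae_all_iff]
  intro j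
  exact (Measure.quasiMeasurePreserving_eval
    (μ := fun _ : Fin p => volume.restrict (Set.Ioi (0 : ℝ))) j).ae
    (ae_restrict_mem measurableSet_Ioi)

/-! ### Integrating out the local scales -/

theorem lintegral_coefPrior_mul_localPrior_mul_coefKernel (α : ℝ) {τ : ℝ} (hτ : 0 < τ)
    (b c : Fin p → ℝ) :
    ∫⁻ l, coefPrior τ l b * localPrior α l * coefKernel τ l c ∂(localRef p) =
      ∏ j, ENNReal.ofReal (Real.sqrt (2 * Real.pi) * τ)⁻¹ *
        bridgeMix α ((b j / τ) ^ 2 + (c j / τ) ^ 2) := by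
  simp only [coefPrior, localPrior, coefKernel, ← Finset.prod_mul_distrib]
  have hm : ∀ j, Measurable fun x : ℝ => gaussianPDF 0 (Real.toNNReal (τ ^ 2 * x ^ 2)) (b j) *
      bridgeLocalDensity α x * ENNReal.ofReal (Real.exp (-((c j / τ) ^ 2 / (2 * x ^ 2)))) := by
    intro j
    have h1 : Measurable fun x : ℝ => gaussianPDF 0 (Real.toNNReal (τ ^ 2 * x ^ 2)) (b j) :=
      (measurable_uncurry_gaussianPDFReal.comp (by fun_prop : Measurable fun x : ℝ =>
        ((0 : ℝ), Real.toNNReal (τ ^ 2 * x ^ 2), b j))).ennreal_ofReal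
    fun_prop
  rw [localRef, lintegral_pi_prod_eq_prod _ hm]
  exact Finset.prod_congr rfl fun j _ =>
    lintegral_gaussianPDF_mul_exp_mul_bridgeLocalDensity α hτ (b j) (c j)

theorem lintegral_coefPrior_mul_localPrior (α : ℝ) {τ : ℝ} (hτ : 0 < τ) (b : Fin p → ℝ) :
    ∫⁻ l, coefPrior τ l b * localPrior α l ∂(localRef p) =
      ∏ j, ENNReal.ofReal (Real.sqrt (2 * Real.pi) * τ)⁻¹ * bridgeMix α ((b j / τ) ^ 2) := by
  have h := lintegral_coefPrior_mul_localPrior_mul_coefKernel α hτ b 0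
  simpa [coefKernel] using h

/-- The minorizing density, relative to the likelihood. -/
noncomputable def bridgeMinorant (α τmin : ℝ) (β : Fin p → ℝ) : ℝ≥0∞ :=
  ∏ j, bridgeMix α ((β j / τmin) ^ 2) / bridgeMix α 0

theorem measurable_bridgeMinorant (α τmin : ℝ) :
    Measurable (bridgeMinorant (p := p) α τmin) := by
  have := measurable_bridgeMix α
  unfold bridgeMinorant
  fun_prop

theorem bridgeMinorant_le_one {α τmin : ℝ} (β : Fin p → ℝ) : bridgeMinorant α τmin β ≤ 1 :=
  Finset.prod_le_one' fun _ _ =>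
    ENNReal.div_le_of_le_mul (by rw [one_mul]; exact bridgeMix_antitone α (sq_nonneg _))

theorem bridgeMinorant_ne_zero {α τmin : ℝ} (hα0 : 0 < α) (hα1 : α < 1) (β : Fin p → ℝ) :
    bridgeMinorant α τmin β ≠ 0 :=
  Finset.prod_ne_zero_iff.2 fun _ _ => ENNReal.div_ne_zero.2
    ⟨(bridgeMix_pos hα0 hα1 _).ne', (bridgeMix_lt_top hα0 hα1 le_rfl).ne⟩

/-- The expectation of the kernel at `β` under `l | b, τ` is bounded below uniformly in `b` and `τ`:
`bridgeMix_mul_le` removes `b`, then monotonicity and `τmin ≤ τ` remove `τ`. -/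
theorem bridgeMinorant_mul_le {α τmin τ : ℝ} (hτmin : 0 < τmin) (hτ : τmin ≤ τ)
    (b β : Fin p → ℝ) :
    bridgeMinorant α τmin β * ∫⁻ l, coefPrior τ l b * localPrior α l ∂(localRef p) ≤
      ∫⁻ l, coefPrior τ l b * localPrior α l * coefKernel τ l β ∂(localRef p) := by
  have hτ0 := hτmin.trans_le hτ
  rw [lintegral_coefPrior_mul_localPrior α hτ0,
    lintegral_coefPrior_mul_localPrior_mul_coefKernel α hτ0, bridgeMinorant,
    ← Finset.prod_mul_distrib]
  refine Finset.prod_le_prod' fun j _ => ?_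
  rw [mul_left_comm]
  gcongr
  rw [div_eq_mul_inv, mul_right_comm, ← div_eq_mul_inv]
  refine ENNReal.div_le_of_le_mul ?_
  have h1 : bridgeMix α ((β j / τmin) ^ 2) ≤ bridgeMix α ((β j / τ) ^ 2) := by
    apply bridgeMix_antitone
    rw [div_pow, div_pow]
    gcongr
  calc _ ≤ bridgeMix α ((β j / τ) ^ 2) * bridgeMix α ((b j / τ) ^ 2) := by gcongr
    _ = bridgeMix α ((b j / τ) ^ 2) * bridgeMix α ((β j / τ) ^ 2) := mul_comm _ _
    _ ≤ _ := bridgeMix_mul_le α (sq_nonneg _) (sq_nonneg _)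

theorem IsGlobalScalePrior.ae_ge {τmin : ℝ} {πglo : Measure ℝ}
    (h : IsGlobalScalePrior p τmin πglo) : ∀ᵐ τ ∂πglo, τmin ≤ τ := by
  rw [ae_iff]
  simpa [Set.Iio] using h.support

/-- Each coordinate contributes at most a constant times `τ⁻¹`. The bound does not involve `b`, so
it also yields a proper posterior. -/
theorem lintegral_marginal_le {α τmin : ℝ} (hτmin : 0 < τmin) {πglo : Measure ℝ}
    (h : IsGlobalScalePrior p τmin πglo) (b : Fin p → ℝ) :
    ∫⁻ τ, ∫⁻ l, coefPrior τ l b * localPrior α l ∂(localRef p) ∂πglo ≤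
      (∫⁻ τ, ENNReal.ofReal ((τ ^ p)⁻¹) ∂πglo) *
        (ENNReal.ofReal (Real.sqrt (2 * Real.pi))⁻¹ * bridgeMix α 0) ^ p := by
  have hm : Measurable fun τ : ℝ => ENNReal.ofReal ((τ ^ p)⁻¹) := by fun_prop
  rw [← lintegral_mul_const _ hm]
  refine lintegral_mono_ae ?_
  filter_upwards [h.ae_ge] with τ hτ
  have hτ0 := hτmin.trans_le hτ
  rw [lintegral_coefPrior_mul_localPrior α hτ0]
  calc _ ≤ ∏ _j : Fin p, ENNReal.ofReal (Real.sqrt (2 * Real.pi) * τ)⁻¹ * bridgeMix α 0 := by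
        refine Finset.prod_le_prod' fun j _ => ?_
        gcongr
        exact bridgeMix_antitone α (sq_nonneg _)
    _ = _ := by
      rw [Finset.prod_const, Finset.card_univ, Fintype.card_fin, mul_inv,
        ENNReal.ofReal_mul (by positivity), ← inv_pow, ENNReal.ofReal_pow (by positivity),
        ← mul_pow]
      congr 1
      ring

/-! ### The bridge sampler as a collapsed Gibbs sampler -/

theorem isProperCollapsed_bridge {α ζ τmin : ℝ} (hα0 : 0 < α) (hα1 : α < 1) (hζ : 0 < ζ)
    (hτmin : 0 < τmin) {πglo : Measure ℝ} [SFinite πglo] (h : IsGlobalScalePrior p τmin πglo) :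
    IsProperCollapsed (volume : Measure (Fin p → ℝ)) (localRef p) πglo
      (fun β => probitLikelihood X y β * fictitiousLikelihood ζ β) coefPrior (localPrior α) := by
  have hinner : ∀ᵐ τ ∂πglo, ∀ b : Fin p → ℝ,
      (∫⁻ l, coefPrior τ l b * localPrior α l ∂(localRef p)) ≠ 0 ∧
        (∫⁻ l, coefPrior τ l b * localPrior α l ∂(localRef p)) ≠ ∞ := by
    filter_upwards [h.ae_ge] with τ hτ b
    have hτ0 := hτmin.trans_le hτ
    rw [lintegral_coefPrior_mul_localPrior α hτ0]
    refine ⟨Finset.prod_ne_zero_iff.2 fun j _ => mul_ne_zero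
      (ENNReal.ofReal_pos.2 (by positivity)).ne' (bridgeMix_pos hα0 hα1 _).ne',
      ENNReal.prod_ne_top fun j _ => ENNReal.mul_ne_top ENNReal.ofReal_ne_top
        (bridgeMix_lt_top hα0 hα1 (sq_nonneg _)).ne⟩
  refine ⟨(measurable_probitLikelihood X y).mul (measurable_fictitiousLikelihood ζ),
    measurable_coefPrior, measurable_localPrior α, hinner, fun b => ⟨?_, ?_⟩, ?_⟩
  · have hm : Measurable fun τ => ∫⁻ l, coefPrior τ l b * localPrior α l ∂(localRef p) := by
      have : Measurable fun q : ℝ × (Fin p → ℝ) => coefPrior q.1 q.2 b * localPrior α q.2 :=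
        (measurable_coefPrior.comp
          (by fun_prop : Measurable fun q : ℝ × (Fin p → ℝ) => (q.1, q.2, b))).mul
          ((measurable_localPrior α).comp measurable_snd)
      exact this.lintegral_prod_right'
    rw [Ne, lintegral_eq_zero_iff hm]
    intro h0
    -- If the outer integral vanished, the positive inner one would vanish almost everywhere,
    -- forcing `πglo = 0`.
    have : ∀ᵐ _ ∂πglo, False := by
      filter_upwards [h0, hinner] with τ h1 h2
      exact (h2 b).1 h1
    have hne : (ae πglo).NeBot := ae_neBot.2 h.ne_zero
    exact this.exists.elim fun _ => id
  · refine ((lintegral_marginal_le hτmin h b).trans_lt (ENNReal.mul_lt_top h.integrable ?_)).ne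
    exact ENNReal.pow_lt_top (ENNReal.mul_lt_top ENNReal.ofReal_lt_top
      (bridgeMix_lt_top hα0 hα1 le_rfl))
  · filter_upwards [(Measure.quasiMeasurePreserving_fst (μ := localRef p) (ν := πglo)).ae
      (ae_localRef_pos p), (Measure.quasiMeasurePreserving_snd (μ := localRef p) (ν := πglo)).ae
      h.ae_ge] with z hl hτ
    have hτ0 := hτmin.trans_le hτ
    exact ⟨lintegral_weight_mul_coefPrior_ne_zero X y hζ hτ0 hl,
      ((lintegral_weight_mul_coefPrior_le X y hζ hτ0 hl).trans_lt
        (coefNorm_ne_top z.2 z.1).lt_top).ne⟩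

theorem minorant_le_coefTransitionDensity {α ζ τmin : ℝ} (hα0 : 0 < α) (hα1 : α < 1)
    (hζ : 0 < ζ) (hτmin : 0 < τmin) {πglo : Measure ℝ} [SFinite πglo]
    (h : IsGlobalScalePrior p τmin πglo) (b β : Fin p → ℝ) :
    probitLikelihood X y β * fictitiousLikelihood ζ β * bridgeMinorant α τmin β ≤
      coefTransitionDensity α ζ X y πglo b β := by
  refine (isProperCollapsed_bridge X y hα0 hα1 hζ hτmin h).le_lintegral_density b β
    (bridgeMinorant α τmin β) (e := fun τ l => coefKernel τ l β) ?_ ?_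
  · filter_upwards [h.ae_ge] with τ hτ
    filter_upwards [ae_localRef_pos p] with l hl
    exact weight_mul_coefKernel_le X y hζ (hτmin.trans_le hτ) hl β
  · filter_upwards [h.ae_ge] with τ hτ
    exact bridgeMinorant_mul_le hτmin hτ b β

theorem uniformMinorization_coefTransitionDensity {α ζ τmin : ℝ} (hα0 : 0 < α) (hα1 : α < 1)
    (hζ : 0 < ζ) (hτmin : 0 < τmin) {πglo : Measure ℝ} [SFinite πglo]
    (h : IsGlobalScalePrior p τmin πglo) :
    UniformMinorization volume (coefTransitionDensity α ζ X y πglo) := by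
  set φ : (Fin p → ℝ) → ℝ≥0∞ := fun β =>
    probitLikelihood X y β * fictitiousLikelihood ζ β * bridgeMinorant α τmin β with hφ
  have hφm : Measurable φ :=
    ((measurable_probitLikelihood X y).mul (measurable_fictitiousLikelihood ζ)).mul
      (measurable_bridgeMinorant α τmin)
  have hlt : ∫⁻ β, φ β ≠ ∞ := by
    refine (lt_of_le_of_lt ?_ ENNReal.one_lt_top).ne
    refine (lintegral_mono fun β => ?_).trans (lintegral_weight_le_one X y hζ)
    exact mul_le_of_le_one_right' (bridgeMinorant_le_one β)
  have hne : ∫⁻ β, φ β ≠ 0 := by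
    refine ((lintegral_pos_iff_support hφm).2 ?_).ne'
    have hs : Function.support φ = Set.univ := Set.eq_univ_of_forall fun β =>
      mul_ne_zero (mul_ne_zero (probitLikelihood_ne_zero X y β)
        (fictitiousLikelihood_ne_zero hζ β)) (bridgeMinorant_ne_zero hα0 hα1 β)
    rw [hs]
    exact Measure.measure_univ_pos.2 (NeZero.ne _)
  -- The constant `δ` is the mass of the unnormalized minorant, which is positive and at most one.
  refine ⟨(∫⁻ β, φ β).toReal, fun β => φ β / ∫⁻ β', φ β', ENNReal.toReal_pos hne hlt,
    hφm.div_const _, ?_, fun b β => ?_⟩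
  · simp_rw [div_eq_mul_inv]
    rw [lintegral_mul_const _ hφm, ENNReal.mul_inv_cancel hne hlt]
  · rw [ENNReal.ofReal_toReal hlt, ENNReal.mul_div_cancel hne hlt]
    exact minorant_le_coefTransitionDensity X y hα0 hα1 hζ hτmin h b β

/-- `Kernel.withDensity` is the zero kernel unless the density is jointly measurable, so
measurability is needed before the kernel can be unfolded. The result depends on `s` only through
`s.1`. -/
theorem gibbsKernel_apply {α ζ τmin : ℝ} (hα0 : 0 < α) (hα1 : α < 1)
    (hζ : 0 < ζ) (hτmin : 0 < τmin) {πglo : Measure ℝ} [SFinite πglo]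
    (h : IsGlobalScalePrior p τmin πglo) (s : GibbsState p) :
    gibbsKernel α ζ X y πglo s = (stateRef p πglo).withDensity
      (collapsedDensity volume (localRef p) πglo
        (fun β => probitLikelihood X y β * fictitiousLikelihood ζ β) coefPrior (localPrior α)
        s.1) := by
  have hd : gibbsDensity α ζ X y πglo = fun s s' => collapsedDensity volume (localRef p) πglo
      (fun β => probitLikelihood X y β * fictitiousLikelihood ζ β) coefPrior (localPrior α)
      s.1 s' := by
    funext s s'
    simp only [gibbsDensity, globalScaleCond, localScaleCond, coefCond, coefMarginalPrior,
      collapsedDensity]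
  have hm : Measurable (Function.uncurry (gibbsDensity α ζ X y πglo)) := by
    rw [hd]
    have h1 := (isProperCollapsed_bridge X y hα0 hα1 hζ hτmin h).measurable_density
    have h2 : Measurable fun q : GibbsState p × GibbsState p => (q.1.1, q.2) := by fun_prop
    have h3 := h1.comp h2
    exact h3
  rw [gibbsKernel, Kernel.withDensity_apply _ hm, Kernel.const_apply, hd]

theorem isProbabilityMeasure_bridgePosterior {α ζ τmin : ℝ} (hα0 : 0 < α) (hα1 : α < 1)
    (hζ : 0 < ζ) (hτmin : 0 < τmin) {πglo : Measure ℝ} [SFinite πglo]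
    (h : IsGlobalScalePrior p τmin πglo) :
    IsProbabilityMeasure (bridgePosterior α ζ X y πglo) := by
  have hc := isProperCollapsed_bridge X y hα0 hα1 hζ hτmin h
  have hZ : ∫⁻ s, jointDensity α ζ X y s ∂(stateRef p πglo) =
      ∫⁻ b, probitLikelihood X y b * fictitiousLikelihood ζ b *
        ∫⁻ τ, ∫⁻ l, coefPrior τ l b * localPrior α l ∂(localRef p) ∂πglo := hc.lintegral_joint
  have hwm : Measurable fun b : Fin p → ℝ => probitLikelihood X y b * fictitiousLikelihood ζ b :=
    hc.measurable_weight
  have hlt : ∫⁻ s, jointDensity α ζ X y s ∂(stateRef p πglo) ≠ ∞ := by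
    rw [hZ]
    refine ((lintegral_mono fun b => mul_le_mul_right
      (lintegral_marginal_le (α := α) hτmin h b) _).trans_lt ?_).ne
    rw [lintegral_mul_const _ hwm]
    refine ENNReal.mul_lt_top ((lintegral_weight_le_one X y hζ).trans_lt ENNReal.one_lt_top)
      (ENNReal.mul_lt_top h.integrable ?_)
    exact ENNReal.pow_lt_top (ENNReal.mul_lt_top ENNReal.ofReal_lt_top
      (bridgeMix_lt_top hα0 hα1 le_rfl))
  have hne : ∫⁻ s, jointDensity α ζ X y s ∂(stateRef p πglo) ≠ 0 := by
    rw [hZ]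
    have hs : Function.support (fun b : Fin p → ℝ =>
        probitLikelihood X y b * fictitiousLikelihood ζ b *
        ∫⁻ τ, ∫⁻ l, coefPrior τ l b * localPrior α l ∂(localRef p) ∂πglo) = Set.univ :=
      Set.eq_univ_of_forall fun b =>
        mul_ne_zero (mul_ne_zero (probitLikelihood_ne_zero X y b)
          (fictitiousLikelihood_ne_zero hζ b)) (hc.outer b).1
    have hm : Measurable fun b : Fin p → ℝ => probitLikelihood X y b * fictitiousLikelihood ζ b *
        ∫⁻ τ, ∫⁻ l, coefPrior τ l b * localPrior α l ∂(localRef p) ∂πglo :=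
      hwm.mul hc.measurable_outer
    refine ((lintegral_pos_iff_support hm).2 ?_).ne'
    rw [hs]
    exact Measure.measure_univ_pos.2 (NeZero.ne _)
  refine ⟨?_⟩
  rw [bridgePosterior, Measure.smul_apply, withDensity_apply _ MeasurableSet.univ,
    Measure.restrict_univ, smul_eq_mul, ENNReal.inv_mul_cancel hne hlt]

theorem isMarkovKernel_gibbsKernel {α ζ τmin : ℝ} (hα0 : 0 < α) (hα1 : α < 1)
    (hζ : 0 < ζ) (hτmin : 0 < τmin) {πglo : Measure ℝ} [SFinite πglo]
    (h : IsGlobalScalePrior p τmin πglo) : IsMarkovKernel (gibbsKernel α ζ X y πglo) := by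
  refine ⟨fun s => ⟨?_⟩⟩
  rw [gibbsKernel_apply X y hα0 hα1 hζ hτmin h, withDensity_apply _ MeasurableSet.univ,
    Measure.restrict_univ]
  exact (isProperCollapsed_bridge X y hα0 hα1 hζ hτmin h).lintegral_density s.1

theorem invariant_bridgePosterior {α ζ τmin : ℝ} (hα0 : 0 < α) (hα1 : α < 1)
    (hζ : 0 < ζ) (hτmin : 0 < τmin) {πglo : Measure ℝ} [SFinite πglo]
    (h : IsGlobalScalePrior p τmin πglo) :
    (gibbsKernel α ζ X y πglo).Invariant (bridgePosterior α ζ X y πglo) := by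
  have hc := isProperCollapsed_bridge X y hα0 hα1 hζ hτmin h
  have hJ : Measurable (jointDensity (p := p) α ζ X y) := hc.measurable_joint
  refine Measure.ext fun A hA => ?_
  rw [Measure.bind_apply hA (Kernel.aemeasurable _), bridgePosterior, lintegral_smul_measure,
    lintegral_withDensity_eq_lintegral_mul _ hJ (Kernel.measurable_coe _ hA), Measure.smul_apply,
    withDensity_apply _ hA]
  -- The posterior's normalizing constant factors out of both sides; the rest is invariance of the
  -- unnormalized joint density, tested on an indicator.
  congr 1
  have hg : Measurable (A.indicator (1 : GibbsState p → ℝ≥0∞)) := measurable_one.indicator hA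
  have key := hc.lintegral_joint_mul_density hg
  have e1 : ∀ s, gibbsKernel α ζ X y πglo s A = ∫⁻ s', collapsedDensity volume (localRef p) πglo
        (fun β => probitLikelihood X y β * fictitiousLikelihood ζ β) coefPrior (localPrior α)
        s.1 s' * A.indicator 1 s' ∂(stateRef p πglo) := by
    intro s
    rw [gibbsKernel_apply X y hα0 hα1 hζ hτmin h, withDensity_apply _ hA,
      ← lintegral_indicator hA]
    refine lintegral_congr fun s' => ?_
    by_cases hs : s' ∈ A <;> simp [hs]
  have e2 : ∫⁻ s in A, jointDensity α ζ X y s ∂(stateRef p πglo) =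
      ∫⁻ s, jointDensity α ζ X y s * A.indicator 1 s ∂(stateRef p πglo) := by
    rw [← lintegral_indicator hA]
    refine lintegral_congr fun s' => ?_
    by_cases hs : s' ∈ A <;> simp [hs]
  rw [e2]
  simp only [Pi.mul_apply, e1]
  exact key

theorem gibbsKernel_preimage_fst {α ζ τmin : ℝ} (hα0 : 0 < α) (hα1 : α < 1)
    (hζ : 0 < ζ) (hτmin : 0 < τmin) {πglo : Measure ℝ} [SFinite πglo]
    (h : IsGlobalScalePrior p τmin πglo) (s : GibbsState p) {A : Set (Fin p → ℝ)}
    (hA : MeasurableSet A) :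
    gibbsKernel α ζ X y πglo s (Prod.fst ⁻¹' A) =
      ∫⁻ β in A, coefTransitionDensity α ζ X y πglo s.1 β := by
  rw [gibbsKernel_apply X y hα0 hα1 hζ hτmin h, withDensity_apply _ (measurable_fst hA)]
  exact (isProperCollapsed_bridge X y hα0 hα1 hζ hτmin h).lintegral_preimage_fst s.1 A

end Model

/-- Uniform ergodicity of the conjugate Gibbs sampler for regularized Bayesian bridge probit
regression. -/
theorem mainTheorem9 (n p : ℕ) (X : Matrix (Fin n) (Fin p) ℝ) (y : Fin n → Bool)
    (α : ℝ) (hα0 : 0 < α) (hα1 : α < 1) (ζ : ℝ) (hζ : 0 < ζ)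
    (τmin : ℝ) (hτmin : 0 < τmin)
    (πglo : Measure ℝ) [SFinite πglo] (hglo : IsGlobalScalePrior p τmin πglo) :
    UniformlyErgodic (gibbsKernel α ζ X y πglo) (bridgePosterior α ζ X y πglo) ∧
      UniformMinorization volume (coefTransitionDensity α ζ X y πglo) := by
  have hmin := uniformMinorization_coefTransitionDensity X y hα0 hα1 hζ hτmin hglo
  refine ⟨?_, hmin⟩
  obtain ⟨δ, φ, hδ, hφm, hφ1, hle⟩ := hmin
  have := isMarkovKernel_gibbsKernel X y hα0 hα1 hζ hτmin hglo
  have := isProbabilityMeasure_bridgePosterior X y hα0 hα1 hζ hτmin hglo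
  have hν : IsProbabilityMeasure ((volume : Measure (Fin p → ℝ)).withDensity φ) :=
    ⟨by rw [withDensity_apply _ MeasurableSet.univ, Measure.restrict_univ, hφ1]⟩
  -- The current scales do not influence the next step, so the zeros in the section `g` are
  -- arbitrary fillers.
  refine uniformlyErgodic_of_minorization _ _
    (invariant_bridgePosterior X y hα0 hα1 hζ hτmin hglo) (f := Prod.fst)
    (g := fun b => (b, 0, 0)) measurable_fst (by fun_prop) (fun s => ?_)
    ((volume : Measure (Fin p → ℝ)).withDensity φ) hδ fun s A hA => ?_
  · rw [gibbsKernel_apply X y hα0 hα1 hζ hτmin hglo, gibbsKernel_apply X y hα0 hα1 hζ hτmin hglo]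
  · rw [gibbsKernel_preimage_fst X y hα0 hα1 hζ hτmin hglo s hA, withDensity_apply _ hA,
      ← lintegral_const_mul _ hφm]
    exact lintegral_mono fun β => hle s.1 β
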